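/- Theorem 1.4. For every $\varepsilon>0$ there exist constants $C=C(\varepsilon)>0$ and $c=c(\varepsilon)>0$ such that the following holds. Let $n$ and $d\ge 2$ be integers, let $\lambda$ be a real number, and let $G$ be an $(n,d,\lambda)$-graph, that is, a $d$-regular graph on $n$ vertices whose adjacency matrix has eigenvalues $\lambda_1\ge\lambda_2\ge\dots\ge\lambda_n$ with $\max\{\lambda_2,|\lambda_n|\}\le\lambda$. Suppose that $$\frac d\lambda\ \ge\ C\log d\qquad\text{and}\qquad d\ \le\ c\,\frac{n}{\log^2 n}$$ (with natural logarithms). In other words, $d/\lambda=\omega(\log d)$ and $d=o(n/\log^2 n)$. Then for every vertex $r$ of $G$ there are at least $(1-\varepsilon)d$ vertex-independent spanning trees of $G$ rooted at $r$: distinct spanning trees $T_1,\dots,T_k$ of $G$ with $k\ge(1-\varepsilon)d$ such that, for every vertex $v$ and all $i\ne j$, the unique $r$–$v$ path in $T_i$ and the unique $r$–$v$ path in $T_j$ share no vertices other than $r$ and $v$. -/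

import Mathlib

theorem adjMatrix_real_isHermitian {V : Type*} (G : SimpleGraph V) [DecidableRel G.Adj] :
    (G.adjMatrix ℝ).IsHermitian := by
  rw [Matrix.IsHermitian, Matrix.conjTranspose_eq_transpose_of_trivial]
  exact G.isSymm_adjMatrix

/-- The adjacency eigenvalues of `G` (counted with multiplicity) in decreasing order:
`adjEigenvalue G i` is the `(i + 1)`-st largest one, usually written `λ_{i + 1}`. -/
noncomputable def adjEigenvalue {V : Type*} [Fintype V] [DecidableEq V] (G : SimpleGraph V)
    [DecidableRel G.Adj] (i : Fin (Fintype.card V)) : ℝ :=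
  (adjMatrix_real_isHermitian G).eigenvalues₀ i

/-- `G` is an `(n, d, lam)`-graph: it has `n` vertices, it is `d`-regular, and its adjacency
eigenvalues `λ₁ ≥ ⋯ ≥ λₙ` satisfy `λ₂ ≤ lam` and `|λₙ| ≤ lam`.
Indices are shifted by one. -/
structure IsNDLambdaGraph {V : Type*} [Fintype V] [DecidableEq V] (G : SimpleGraph V)
    [DecidableRel G.Adj] (n d : ℕ) (lam : ℝ) : Prop where
  card_eq : Fintype.card V = n
  regular : G.IsRegularOfDegree d
  second_le : ∀ i : Fin (Fintype.card V), i.val = 1 → adjEigenvalue G i ≤ lam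
  abs_last_le : ∀ i : Fin (Fintype.card V), i.val + 1 = Fintype.card V →
    |adjEigenvalue G i| ≤ lam

/-- `T` is a family of `k` (distinct) vertex-independent spanning trees of `G` rooted at `r`.
A tree that is a `SimpleGraph` on the whole vertex type `V` is automatically spanning. For each
vertex `v`, the `r`-`v` paths in two different trees share no vertices other than `r` and `v`. -/
structure IsIndependentSpanningTrees {V : Type*} (G : SimpleGraph V) (r : V) {k : ℕ}
    (T : Fin k → SimpleGraph V) : Prop where
  injective : Function.Injective T
  le : ∀ i, T i ≤ G
  isTree : ∀ i, (T i).IsTree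
  disjoint : ∀ i j, i ≠ j → ∀ (v : V) (p : (T i).Walk r v) (q : (T j).Walk r v),
    p.IsPath → q.IsPath → ∀ x, x ∈ p.support → x ∈ q.support → x = r ∨ x = v

/-! Put `k ≈ (1-ε)d` and pick neighbours `u i` of `r`, one for each tree. It suffices to find
disjoint connected sets `S i ∋ u i` avoiding `r`, and for every vertex `v` distinct connectors `w v
i`, outside all the sets `S j`, joining `v` to those `S i` that `v` does not touch. Tree `i` then
consists of a breadth-first tree of `S i` hung on `r` at `u i`; every other vertex is attached
directly to `S i` if possible, and through `w v i` otherwise. The `r`–`v` path of tree `i` stays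
inside `{r, v, w v i} ∪ S i`, and these sets overlap only in `r` and `v` (the root-level
`exists_independentSpanningTrees`).

The sets come from two random labellings controlled by the local lemma. `exists_splitting` reserves
disjoint sets `A` and `Z` in which every vertex has at least `γd` neighbours, while most neighbours
stay free to be connectors. `exists_colouring` colours a sparse part of `Z`, with classes `τ i`, so
that at each `v` Hall's condition holds for matching the colours `v` still needs to neighbours that
see these colours. The hypothesis `d/λ ≥ C log d` enters here: by expander mixing, `γd` vertices
have of order `d log² d` neighbours in `Z`, so with about `d log d` labels a Hall violation has
probability polynomially small in `d`, of as high a degree as the local lemma requires.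

It remains to connect `{u i} ∪ τ i` inside `A`, disjointly for all `i`
(`exists_disjoint_connected`). This uses a Friedman–Pippenger extension argument with release:
binary trees are grown from representatives of the components until there are so many leaves that
mixing yields an edge between two trees; only the two branches ending in that edge are kept. There
are `O(n / log d)` coloured vertices and joining one costs `O(log d)` vertices on average, so a
suitable choice of constants makes the total fit into the linear-sized set `A`. The bound `d ≤ c n /
log² n` keeps the expansion requirement, of order `d log² d`, and the cost of the `k` roots `u i`,
of order `d log d`, below a small multiple of `n`. -/

/-! ### Spectral gap and expander mixing. -/

open Matrix in
/-- Bilinear form of the spectral gap: away from the constant vector, the adjacency operator of an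
`(n, d, lam)`-graph has norm at most `lam`. -/
theorem IsNDLambdaGraph.abs_inner_sub_le {V : Type*} [Fintype V] [DecidableEq V] {G : SimpleGraph V}
    [DecidableRel G.Adj] {n d : ℕ} {lam : ℝ} (h : IsNDLambdaGraph G n d lam) (hn : 2 ≤ n)
    (hlam : lam < d) (x y : EuclideanSpace ℝ V) :
    |inner ℝ x (Matrix.toEuclideanLin (G.adjMatrix ℝ) y) - d / n * ((∑ v, x v) * ∑ v, y v)|
      ≤ lam * (‖x‖ * ‖y‖) := by
  classical
  set T := Matrix.toEuclideanLin (G.adjMatrix ℝ) with hT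
  have hA := adjMatrix_real_isHermitian G
  have hTs : T.IsSymmetric := Matrix.isSymmetric_toEuclideanLin_iff.mpr hA
  set b := hA.eigenvectorBasis with hb
  have hTb : ∀ j, T (b j) = hA.eigenvalues j • b j := by
    intro j
    have := hA.mulVec_eigenvectorBasis j
    ext v
    have h2 := congrFun this v
    simpa [hT, Matrix.toLpLin_apply] using h2
  have hcard := h.card_eq
  let e : Fin (Fintype.card V) ≃ V := Fintype.equivOfCardEq (Fintype.card_fin _)
  let i0 : Fin (Fintype.card V) := ⟨0, by omega⟩
  -- By definition, the eigenvalues indexed by `V` are the sorted ones transported along `e`.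
  have hev : ∀ j, hA.eigenvalues j = adjEigenvalue G (e.symm j) := fun j => rfl
  have hanti : Antitone (adjEigenvalue G) := hA.eigenvalues₀_antitone
  have hle : ∀ j, j ≠ e i0 → hA.eigenvalues j ≤ lam := by
    intro j hj
    rw [hev]
    refine le_trans (hanti ?_) (h.second_le ⟨1, by omega⟩ rfl)
    rw [Fin.le_def]
    have : e.symm j ≠ i0 := fun h => hj (by rw [← h]; simp)
    have h2 : (e.symm j).val ≠ 0 := fun h => this (Fin.ext h)
    simp only
    omega
  have hge : ∀ j, -lam ≤ hA.eigenvalues j := by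
    intro j
    rw [hev]
    have h1 := h.abs_last_le ⟨Fintype.card V - 1, by omega⟩ (by simp only; omega)
    refine le_trans (neg_le_of_abs_le h1) (hanti ?_)
    rw [Fin.le_def]
    have := (e.symm j).isLt
    simp only
    omega
  set o : EuclideanSpace ℝ V := WithLp.toLp 2 (fun _ => 1) with ho
  have hTo : T o = (d : ℝ) • o := by
    ext v
    have hv := h.regular v
    rw [← G.card_neighborFinset_eq_degree, SimpleGraph.neighborFinset_eq_filter] at hv
    simp [hT, Matrix.toLpLin_apply, ho, Matrix.mulVec, dotProduct, SimpleGraph.adjMatrix_apply, hv]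
  have hinner : ∀ z w : EuclideanSpace ℝ V,
      inner ℝ z (T w) = ∑ j, hA.eigenvalues j * (inner ℝ z (b j) * inner ℝ (b j) w) := by
    intro z w
    rw [← b.sum_inner_mul_inner]
    refine Finset.sum_congr rfl fun j _ => ?_
    rw [← hTs, hTb, real_inner_smul_left]
    ring
  -- Eigenvectors with eigenvalue at most `lam < d` are orthogonal to the constant vector `o`, whose
  -- eigenvalue is `d`. So `o` is a multiple of the one remaining basis vector, and that vector has
  -- eigenvalue `d`.
  have hbo : ∀ j, j ≠ e i0 → inner ℝ (b j) o = (0 : ℝ) := by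
    intro j hj
    have h1 : inner ℝ (b j) (T o) = inner ℝ (T (b j)) o := (hTs _ _).symm
    rw [hTo, hTb, real_inner_smul_left, real_inner_smul_right] at h1
    have h2 := hle j hj
    have h3 : ((d : ℝ) - hA.eigenvalues j) * inner ℝ (b j) o = 0 := by linarith
    rcases mul_eq_zero.mp h3 with h4 | h4
    · linarith
    · exact h4
  have hxo : ∀ z : EuclideanSpace ℝ V,
      inner ℝ z o = inner ℝ z (b (e i0)) * inner ℝ (b (e i0)) o := by
    intro z
    rw [← b.sum_inner_mul_inner]
    rw [Finset.sum_eq_single (e i0)]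
    · intro j _ hj
      rw [hbo j hj, mul_zero]
    · simp
  have hsum : ∀ z : EuclideanSpace ℝ V, inner ℝ z o = ∑ v, z v := by
    intro z
    simp [ho, PiLp.inner_apply]
  have hoo : inner ℝ o o = (n : ℝ) := by
    rw [hsum]
    simp [ho, hcard]
  have hc2 : inner ℝ (b (e i0)) o * inner ℝ (b (e i0)) o = (n : ℝ) := by
    rw [← hoo, hxo o, real_inner_comm o (b (e i0))]
  have hn0 : (0 : ℝ) < n := by
    have : 0 < n := by omega
    exact_mod_cast this
  have htop : hA.eigenvalues (e i0) = d := by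
    have h1 := hinner o o
    rw [Finset.sum_eq_single (e i0)] at h1
    · rw [hTo, real_inner_smul_right, hoo, real_inner_comm, hc2] at h1
      exact (mul_right_cancel₀ hn0.ne' h1).symm
    · intro j _ hj
      rw [hbo j hj, mul_zero, mul_zero]
    · simp
  have hmain : inner ℝ x (T y) - d / n * ((∑ v, x v) * ∑ v, y v)
      = ∑ j ∈ Finset.univ.erase (e i0),
          hA.eigenvalues j * (inner ℝ x (b j) * inner ℝ (b j) y) := by
    rw [hinner, ← Finset.add_sum_erase _ _ (Finset.mem_univ (e i0)), htop, ← hsum x, ← hsum y,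
      hxo x, hxo y, real_inner_comm y (b (e i0))]
    have : (d : ℝ) / n * (inner ℝ x (b (e i0)) * inner ℝ (b (e i0)) o
        * (inner ℝ y (b (e i0)) * inner ℝ (b (e i0)) o))
        = d / n * (inner ℝ (b (e i0)) o * inner ℝ (b (e i0)) o)
          * (inner ℝ x (b (e i0)) * inner ℝ y (b (e i0))) := by ring
    rw [this, hc2, div_mul_cancel₀ _ hn0.ne', real_inner_comm (b (e i0)) y]
    ring
  rw [hmain]
  have hl0 : 0 ≤ lam := by
    have : (⟨1, by omega⟩ : Fin (Fintype.card V)) ≠ i0 := by simp [i0]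
    have h1 := hle (e ⟨1, by omega⟩) (by simpa using this)
    have h2 := hge (e ⟨1, by omega⟩)
    linarith
  calc |∑ j ∈ Finset.univ.erase (e i0),
          hA.eigenvalues j * (inner ℝ x (b j) * inner ℝ (b j) y)|
      ≤ ∑ j ∈ Finset.univ.erase (e i0), lam * (|inner ℝ x (b j)| * |inner ℝ (b j) y|) := by
        refine (Finset.abs_sum_le_sum_abs _ _).trans (Finset.sum_le_sum fun j hj => ?_)
        rw [abs_mul, abs_mul]
        refine mul_le_mul_of_nonneg_right ?_ (by positivity)
        exact abs_le.mpr ⟨hge j, hle j (Finset.ne_of_mem_erase hj)⟩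
    _ ≤ ∑ j, lam * (|inner ℝ x (b j)| * |inner ℝ (b j) y|) :=
        Finset.sum_le_sum_of_subset_of_nonneg (Finset.subset_univ _)
          fun _ _ _ => by positivity
    _ = lam * ∑ j, |inner ℝ x (b j)| * |inner ℝ (b j) y| := by rw [Finset.mul_sum]
    _ ≤ lam * (‖x‖ * ‖y‖) := by
        refine mul_le_mul_of_nonneg_left ?_ hl0
        refine (Real.sum_mul_le_sqrt_mul_sqrt _ _ _).trans_eq ?_
        have hx2 : ∑ j, |(inner ℝ x (b j) : ℝ)| ^ 2 = ‖x‖ ^ 2 := by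
          rw [← real_inner_self_eq_norm_sq, ← b.sum_inner_mul_inner]
          refine Finset.sum_congr rfl fun j _ => ?_
          rw [sq_abs, real_inner_comm x (b j)]
          ring
        have hy2 : ∑ j, |(inner ℝ (b j) y : ℝ)| ^ 2 = ‖y‖ ^ 2 := by
          rw [← real_inner_self_eq_norm_sq, ← b.sum_inner_mul_inner]
          refine Finset.sum_congr rfl fun j _ => ?_
          rw [sq_abs, real_inner_comm (b j) y]
          ring
        rw [hx2, hy2, Real.sqrt_sq (norm_nonneg _), Real.sqrt_sq (norm_nonneg _)]

/-- The expander mixing lemma. -/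
theorem IsNDLambdaGraph.mixing {V : Type*} [Fintype V] [DecidableEq V] {G : SimpleGraph V}
    [DecidableRel G.Adj] {n d : ℕ} {lam : ℝ} (h : IsNDLambdaGraph G n d lam) (hn : 2 ≤ n)
    (hlam : lam < d) (X Y : Finset V) :
    |(∑ x ∈ X, ((G.neighborFinset x ∩ Y).card : ℝ)) - d / n * (X.card * Y.card)|
      ≤ lam * (√X.card * √Y.card) := by
  classical
  let ind : Finset V → EuclideanSpace ℝ V := fun S => WithLp.toLp 2 (fun v => if v ∈ S then 1 else 0)
  have hnorm : ∀ S, ‖ind S‖ = √S.card := by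
    intro S
    rw [EuclideanSpace.norm_eq]
    congr 1
    simp [ind, apply_ite]
  have hsum : ∀ S, ∑ v, ind S v = S.card := by
    intro S
    simp [ind]
  have := h.abs_inner_sub_le hn hlam (ind X) (ind Y)
  rw [hnorm, hnorm, hsum, hsum] at this
  convert this using 3
  simp only [ind, PiLp.inner_apply, Matrix.toLpLin_apply, Matrix.mulVec, dotProduct,
    SimpleGraph.adjMatrix_apply]
  rw [← Finset.sum_filter_add_sum_filter_not Finset.univ (· ∈ X)]
  have hz : ∑ v ∈ Finset.univ.filter (fun v => ¬ v ∈ X),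
      inner ℝ (if v ∈ X then (1 : ℝ) else 0)
        (∑ w, (if G.Adj v w then (1 : ℝ) else 0) * if w ∈ Y then 1 else 0) = 0 := by
    refine Finset.sum_eq_zero fun v hv => ?_
    rw [if_neg (Finset.mem_filter.mp hv).2, inner_zero_left]
  rw [hz, add_zero, Finset.filter_univ_mem]
  refine Finset.sum_congr rfl fun v hv => ?_
  rw [if_pos hv]
  simp only [RCLike.inner_apply, conj_trivial, mul_one, mul_ite, mul_zero]
  rw [← Finset.sum_filter, ← Finset.sum_filter, Finset.filter_mem_eq_inter, Finset.inter_comm]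
  simp only [Finset.sum_const, nsmul_eq_mul, mul_one]
  congr 2
  ext w
  simp

/-! ### Uniform random labellings and the local lemma. -/

section LocalLemma

variable {V ι : Type*} [Fintype V] [DecidableEq V] [Fintype ι]

open Classical in
/-- Probability of an event under a uniformly random labelling of `V` by `ι`. -/
noncomputable def labelProb (E : Set (V → ι)) : ℝ :=
  (Finset.univ.filter (· ∈ E)).card / Fintype.card (V → ι)

/-- The event `E` depends only on the labels in `D`. -/
def DependsOnLabels (E : Set (V → ι)) (D : Finset V) : Prop :=
  ∀ f g : V → ι, (∀ v ∈ D, f v = g v) → f ∈ E → g ∈ E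

theorem labelProb_nonneg (E : Set (V → ι)) : 0 ≤ labelProb E := by
  unfold labelProb; positivity

theorem labelProb_mono {E F : Set (V → ι)} (h : E ⊆ F) : labelProb E ≤ labelProb F := by
  classical
  unfold labelProb
  gcongr

theorem labelProb_union_le (E F : Set (V → ι)) :
    labelProb (E ∪ F) ≤ labelProb E + labelProb F := by
  classical
  unfold labelProb
  rw [← add_div]
  gcongr
  norm_cast
  refine le_trans (Finset.card_le_card ?_) (Finset.card_union_le _ _)
  intro f
  simp

theorem labelProb_iUnion_le {κ : Type*} (s : Finset κ) (E : κ → Set (V → ι)) :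
    labelProb (⋃ i ∈ s, E i) ≤ ∑ i ∈ s, labelProb (E i) := by
  classical
  induction s using Finset.induction_on with
  | empty => simp [labelProb]
  | insert a s ha ih =>
    rw [Finset.sum_insert ha, Finset.set_biUnion_insert]
    exact (labelProb_union_le _ _).trans (by gcongr)

theorem labelProb_inter_add_diff (E F : Set (V → ι)) :
    labelProb (E ∩ F) + labelProb (E \ F) = labelProb E := by
  classical
  unfold labelProb
  rw [← add_div]
  congr 1
  norm_cast
  rw [← Finset.card_union_of_disjoint]
  · congr 1
    ext f
    by_cases hf : f ∈ F <;> simp [hf]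
  · rw [Finset.disjoint_left]
    intro f
    simp only [Finset.mem_filter, Finset.mem_univ, true_and]
    exact fun h1 h2 => h2.2 h1.2

variable [Nonempty ι]

theorem card_labels_pos : (0 : ℝ) < Fintype.card (V → ι) := by
  exact_mod_cast Fintype.card_pos

theorem labelProb_univ : labelProb (Set.univ : Set (V → ι)) = 1 := by
  classical
  unfold labelProb
  have := card_labels_pos (V := V) (ι := ι)
  simp only [Set.mem_univ, Finset.filter_true, Finset.card_univ]
  exact div_self this.ne'

/-- Events depending on disjoint sets of labels are independent. -/
theorem labelProb_inter_eq {E F : Set (V → ι)} {D D' : Finset V} (hD : Disjoint D D')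
    (hE : DependsOnLabels E D) (hF : DependsOnLabels F D') :
    labelProb (E ∩ F) = labelProb E * labelProb F := by
  classical
  have hpos := card_labels_pos (V := V) (ι := ι)
  have key : (Finset.univ.filter (· ∈ E ∩ F)).card * Fintype.card (V → ι)
      = (Finset.univ.filter (· ∈ E)).card * (Finset.univ.filter (· ∈ F)).card := by
    rw [← Finset.card_univ, ← Finset.card_product, ← Finset.card_product]
    have hmix : ∀ {E F : Set (V → ι)}, DependsOnLabels E D → DependsOnLabels F D' →
        ∀ f g : V → ι, f ∈ E → g ∈ F → D.piecewise f g ∈ E ∩ F := by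
      intro E F hE hF f g hf hg
      refine ⟨hE f _ (fun v hv => by simp [hv]) hf, hF g _ (fun v hv => ?_) hg⟩
      rw [Finset.piecewise_eq_of_notMem _ _ _ (Finset.disjoint_right.mp hD hv)]
    -- Exchanging the labels outside `D` is an involution on pairs of labellings. It carries pairs
    -- whose first entry lies in `E ∩ F` to `E × F`, and back.
    refine Finset.card_nbij' (fun p => (D.piecewise p.1 p.2, D.piecewise p.2 p.1))
      (fun p => (D.piecewise p.1 p.2, D.piecewise p.2 p.1)) ?_ ?_ ?_ ?_
    · rintro ⟨f, g⟩ h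
      simp only [Finset.coe_product, Set.mem_prod, Finset.mem_coe, Finset.mem_filter,
        Finset.mem_univ, true_and, and_true] at h ⊢
      refine ⟨hE f _ (fun v hv => by simp [hv]) h.1, hF f _ (fun v hv => ?_) h.2⟩
      rw [Finset.piecewise_eq_of_notMem _ _ _ (Finset.disjoint_right.mp hD hv)]
    · rintro ⟨f, g⟩ h
      simp only [Finset.coe_product, Set.mem_prod, Finset.mem_coe, Finset.mem_filter,
        Finset.mem_univ, true_and, and_true] at h ⊢
      exact hmix hE hF f g h.1 h.2
    · rintro ⟨f, g⟩ _
      ext v <;> by_cases hv : v ∈ D <;> simp [hv]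
    · rintro ⟨f, g⟩ _
      ext v <;> by_cases hv : v ∈ D <;> simp [hv]
  unfold labelProb
  rw [div_mul_div_comm, div_eq_div_iff hpos.ne' (by positivity)]
  have : ((Finset.univ.filter (· ∈ E ∩ F)).card : ℝ) * Fintype.card (V → ι)
      = (Finset.univ.filter (· ∈ E)).card * (Finset.univ.filter (· ∈ F)).card := by
    exact_mod_cast key
  rw [← mul_assoc]
  convert congrArg (· * (Fintype.card (V → ι) : ℝ)) this

/-- The symmetric Lovász local lemma for uniformly random labellings. -/
theorem local_lemma {κ : Type*} [Fintype κ] [DecidableEq κ] (B : κ → Set (V → ι))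
    (D : κ → Finset V) (hD : ∀ i, DependsOnLabels (B i) (D i)) (p : ℝ) (Δ : ℕ)
    (hp : ∀ i, labelProb (B i) ≤ p)
    (hΔ : ∀ i, (Finset.univ.filter fun j => ¬ Disjoint (D i) (D j)).card ≤ Δ)
    (hp2 : 4 * p * Δ ≤ 1) (hp1 : 2 * p < 1) : ∃ f : V → ι, ∀ i, f ∉ B i := by
  classical
  let N : Finset κ → Set (V → ι) := fun S => {f | ∀ i ∈ S, f ∉ B i}
  have hNanti : ∀ {S T : Finset κ}, S ⊆ T → N T ⊆ N S := fun hST f hf i hi => hf i (hST hi)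
  have hNdep : ∀ S : Finset κ, DependsOnLabels (N S) (S.biUnion D) := by
    intro S f g hfg hf i hi hgi
    refine hf i hi (hD i g f (fun v hv => (hfg v ?_).symm) hgi)
    exact Finset.mem_biUnion.mpr ⟨i, hi, hv⟩
  -- The usual bound `P(B i | N S) ≤ 2p`, multiplied out so that positivity of the conditioning
  -- event is not needed during the induction.
  have main : ∀ m : ℕ, ∀ S : Finset κ, S.card = m → ∀ i,
      labelProb (B i ∩ N S) ≤ 2 * p * labelProb (N S) := by
    intro m
    induction m using Nat.strong_induction_on with
    | _ m ih =>
      intro S hS i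
      have hp0 : 0 ≤ p := (labelProb_nonneg _).trans (hp i)
      set S1 := S.filter fun j => ¬ Disjoint (D i) (D j) with hS1
      set S2 := S.filter fun j => Disjoint (D i) (D j) with hS2
      have hind : labelProb (B i ∩ N S2) = labelProb (B i) * labelProb (N S2) := by
        refine labelProb_inter_eq (D := D i) (D' := S2.biUnion D) ?_ (hD i) (hNdep S2)
        rw [Finset.disjoint_biUnion_right]
        exact fun j hj => (Finset.mem_filter.mp hj).2
      have hub : labelProb (B i ∩ N S) ≤ p * labelProb (N S2) := by
        refine (labelProb_mono (Set.inter_subset_inter_right _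
          (hNanti (T := S) (S := S2) (Finset.filter_subset _ _)))).trans ?_
        rw [hind]
        exact mul_le_mul_of_nonneg_right (hp i) (labelProb_nonneg _)
      -- Passing from `N S2` to `N S` excludes at most `Δ` further events, each of relative size at
      -- most `2p` by induction. The total loss is at most `2pΔ ≤ 1/2`.
      have hlb : labelProb (N S2) ≤ 2 * labelProb (N S) := by
        by_cases hemp : S1 = ∅
        · have : S2 = S := by
            rw [hS2, Finset.filter_eq_self]
            intro j hj
            by_contra hjj
            have : j ∈ S1 := Finset.mem_filter.mpr ⟨hj, hjj⟩
            rw [hemp] at this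
            simp at this
          rw [this]
          linarith [labelProb_nonneg (N S)]
        · have hcard : S2.card < m := by
            rw [← hS]
            obtain ⟨j, hj⟩ := Finset.nonempty_iff_ne_empty.mpr hemp
            refine Finset.card_lt_card ⟨Finset.filter_subset _ _, fun hsub => ?_⟩
            have h1 := Finset.mem_filter.mp hj
            exact h1.2 (Finset.mem_filter.mp (hsub h1.1)).2
          have hcov : N S2 ⊆ N S ∪ ⋃ j ∈ S1, (B j ∩ N S2) := by
            intro f hf
            by_cases hfS : f ∈ N S
            · exact Or.inl hfS
            · right
              simp only [N, Set.mem_ofPred_eq, not_forall, not_not] at hfS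
              obtain ⟨j, hj, hjB⟩ := hfS
              simp only [Set.mem_iUnion]
              refine ⟨j, Finset.mem_filter.mpr ⟨hj, fun hdis => ?_⟩, hjB, hf⟩
              exact hf j (Finset.mem_filter.mpr ⟨hj, hdis⟩) hjB
          have h1 := (labelProb_mono hcov).trans
            ((labelProb_union_le _ _).trans (add_le_add_right (labelProb_iUnion_le _ _) _))
          have h2 : ∑ j ∈ S1, labelProb (B j ∩ N S2)
              ≤ Δ * (2 * p * labelProb (N S2)) := by
            refine (Finset.sum_le_sum fun j _ => ih _ hcard S2 rfl j).trans ?_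
            rw [Finset.sum_const, nsmul_eq_mul]
            refine mul_le_mul_of_nonneg_right ?_
              (mul_nonneg (by linarith) (labelProb_nonneg _))
            norm_cast
            refine (Finset.card_le_card ?_).trans (hΔ i)
            exact Finset.filter_subset_filter _ (Finset.subset_univ _)
          have h3 := labelProb_nonneg (N S2)
          nlinarith
      nlinarith [labelProb_nonneg (N S2)]
  have hpos : ∀ S : Finset κ, 0 < labelProb (N S) := by
    intro S
    induction S using Finset.induction_on with
    | empty =>
      have : N ∅ = Set.univ := by ext; simp [N]
      rw [this, labelProb_univ]
      exact one_pos
    | insert i S hi ih =>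
      have h1 := main _ S rfl i
      have h2 : N S \ B i ⊆ N (insert i S) := by
        intro f hf j hj
        rcases Finset.mem_insert.mp hj with rfl | hj
        · exact hf.2
        · exact hf.1 j hj
      have h3 := labelProb_mono h2
      have h4 := labelProb_inter_add_diff (N S) (B i)
      rw [Set.inter_comm] at h4
      nlinarith
  have h1 := hpos Finset.univ
  by_contra hne
  push Not at hne
  have : N Finset.univ = ∅ := by
    ext f
    simp only [N, Finset.mem_univ, true_imp_iff, Set.mem_ofPred_eq, Set.mem_empty_iff_false,
      iff_false, not_forall, not_not]
    exact hne f
  rw [this] at h1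
  simp [labelProb] at h1

/-- The expectation of a product over distinct vertices factorizes. -/
theorem sum_prod_labels (D : Finset V) (g : ι → ℝ) :
    (∑ f : V → ι, ∏ v ∈ D, g (f v)) / Fintype.card (V → ι)
      = ((∑ j, g j) / Fintype.card ι) ^ D.card := by
  classical
  have hι : (0 : ℝ) < Fintype.card ι := by exact_mod_cast Fintype.card_pos
  have h1 : ∀ f : V → ι, ∏ v ∈ D, g (f v) = ∏ v, if v ∈ D then g (f v) else 1 := by
    intro f
    rw [← Finset.prod_filter, Finset.filter_univ_mem]
  have h2 : ∑ f : V → ι, ∏ v, (if v ∈ D then g (f v) else 1)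
      = ∏ v : V, ∑ j : ι, if v ∈ D then g j else 1 := by
    rw [Finset.prod_univ_sum, Fintype.piFinset_univ]
  simp_rw [h1]
  rw [h2, Fintype.card_fun, Nat.cast_pow, ← Finset.card_univ (α := V), ← Finset.prod_const,
    ← Finset.prod_div_distrib]
  rw [← Finset.prod_const, ← Finset.filter_univ_mem D, Finset.prod_filter, Finset.filter_univ_mem]
  refine Finset.prod_congr rfl fun v _ => ?_
  split_ifs with hv
  · rfl
  · simp only [Finset.sum_const, Finset.card_univ, nsmul_eq_mul, mul_one]
    exact div_self hι.ne'

/-- Markov's inequality for products over distinct vertices. -/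
theorem labelProb_prod_ge_le (D : Finset V) (g : ι → ℝ) (hg : ∀ j, 0 ≤ g j) {t : ℝ} (ht : 0 < t)
    (E : Set (V → ι)) (hE : ∀ f ∈ E, t ≤ ∏ v ∈ D, g (f v)) :
    labelProb E ≤ ((∑ j, g j) / Fintype.card ι) ^ D.card / t := by
  classical
  rw [← sum_prod_labels, labelProb, div_right_comm]
  refine div_le_div_of_nonneg_right ?_ (card_labels_pos).le
  rw [le_div_iff₀ ht, ← nsmul_eq_mul, ← Finset.sum_const]
  calc ∑ f ∈ Finset.univ.filter (· ∈ E), t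
      ≤ ∑ f ∈ Finset.univ.filter (· ∈ E), ∏ v ∈ D, g (f v) :=
        Finset.sum_le_sum fun f hf => hE f (Finset.mem_filter.mp hf).2
    _ ≤ _ := Finset.sum_le_sum_of_subset_of_nonneg (Finset.filter_subset _ _)
        fun f _ _ => Finset.prod_nonneg fun v _ => hg _

end LocalLemma

/-! ### Friedman–Pippenger forests: extension and release. -/

section ForestEmbedding

variable {V : Type*}

/-- `x` and `y` are joined by a walk of `G` inside `S`. -/
def ReachIn (G : SimpleGraph V) (S : Finset V) : V → V → Prop :=
  Relation.ReflTransGen fun a b => G.Adj a b ∧ a ∈ S ∧ b ∈ S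

theorem ReachIn.mono {G : SimpleGraph V} {S T : Finset V} (h : S ⊆ T) {x y : V}
    (hxy : ReachIn G S x y) : ReachIn G T x y :=
  Relation.ReflTransGen.mono (p := fun a b => G.Adj a b ∧ a ∈ T ∧ b ∈ T)
    (fun _ _ hab => ⟨hab.1, h hab.2.1, h hab.2.2⟩) _ _ hxy

theorem ReachIn.symm {G : SimpleGraph V} {S : Finset V} {x y : V}
    (hxy : ReachIn G S x y) : ReachIn G S y x := by
  induction hxy with
  | refl => exact Relation.ReflTransGen.refl
  | tail _ hab ih => exact Relation.ReflTransGen.head ⟨hab.1.symm, hab.2.2, hab.2.1⟩ ih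

variable [DecidableEq V]

/-- A Friedman–Pippenger type invariant: when the vertices of `U` are occupied, every set `X` of at
most `2 * m` vertices has enough free neighbours to give `f x` of them to each `x ∈ X`. -/
def ForestReady (nb : V → Finset V) (m : ℕ) (U : Finset V) (f : V → ℤ) : Prop :=
  ∀ X : Finset V, X.card ≤ 2 * m → ∑ x ∈ X, f x ≤ ((X.biUnion nb \ U).card : ℤ)

variable {nb : V → Finset V} {m : ℕ} {U : Finset V} {f : V → ℤ}

/-- One of the free neighbours of `s` can be occupied without destroying the invariant. -/
theorem ForestReady.exists_insert (hm : 1 ≤ m) (hready : ForestReady nb m U f)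
    (hslack : ∀ X : Finset V, m ≤ X.card → X.card ≤ 2 * m →
      ∑ x ∈ X, f x < ((X.biUnion nb \ U).card : ℤ))
    {s : V} (hs : 1 ≤ f s) :
    ∃ y ∈ nb s, y ∉ U ∧ ForestReady nb m (insert y U) (Function.update f s (f s - 1)) := by
  by_contra hcon
  push Not at hcon
  -- If occupying `y` breaks the invariant at `X`, then `s ∉ X`, since otherwise the demand drops by
  -- one as well. Moreover `y` was a free neighbour of `X` and `X` was tight; the strict slack for
  -- large sets forces `X.card < m`.
  have htight : ∀ y ∈ nb s \ U, ∃ X : Finset V, X.card < m ∧ s ∉ X ∧ y ∈ X.biUnion nb ∧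
      ∑ x ∈ X, f x = ((X.biUnion nb \ U).card : ℤ) := by
    intro y hy
    rw [Finset.mem_sdiff] at hy
    have h1 := hcon y hy.1 hy.2
    unfold ForestReady at h1
    push Not at h1
    obtain ⟨X, hX, hlt⟩ := h1
    have hX' := hready X hX
    have hins : X.biUnion nb \ insert y U = (X.biUnion nb \ U).erase y := by
      ext z; simp only [Finset.mem_sdiff, Finset.mem_insert, Finset.mem_erase]; tauto
    rw [hins] at hlt
    have hsX : s ∉ X := by
      intro hsX
      rw [← Finset.add_sum_erase X _ hsX, Function.update_self] at hlt
      have he : ∑ x ∈ X.erase s, Function.update f s (f s - 1) x = ∑ x ∈ X.erase s, f x :=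
        Finset.sum_congr rfl fun x hx => Function.update_of_ne (Finset.ne_of_mem_erase hx) _ _
      rw [he] at hlt
      rw [← Finset.add_sum_erase X f hsX] at hX'
      have := Finset.pred_card_le_card_erase (s := X.biUnion nb \ U) (a := y)
      omega
    have he : ∑ x ∈ X, Function.update f s (f s - 1) x = ∑ x ∈ X, f x :=
      Finset.sum_congr rfl fun x hx => Function.update_of_ne (ne_of_mem_of_not_mem hx hsX) _ _
    rw [he] at hlt
    have hyX : y ∈ X.biUnion nb := by
      by_contra hyX
      rw [Finset.erase_eq_of_notMem (fun h => hyX (Finset.mem_sdiff.mp h).1)] at hlt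
      omega
    rw [Finset.card_erase_of_mem (Finset.mem_sdiff.mpr ⟨hyX, hy.2⟩)] at hlt
    have heq : ∑ x ∈ X, f x = ((X.biUnion nb \ U).card : ℤ) := by omega
    refine ⟨X, ?_, hsX, hyX, heq⟩
    by_contra hmX
    exact (hslack X (by omega) hX).ne heq
  -- Demand is additive and `X ↦ |N(X) \ U|` is submodular, so the union of two tight sets is tight.
  -- It has fewer than `2 * m` elements, and the slack pushes it back below `m`.
  have hcover : ∀ Y : Finset V, Y ⊆ nb s \ U → ∃ X : Finset V, X.card < m ∧ s ∉ X ∧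
      Y ⊆ X.biUnion nb ∧ ∑ x ∈ X, f x = ((X.biUnion nb \ U).card : ℤ) := by
    intro Y
    induction Y using Finset.induction_on with
    | empty => exact fun _ => ⟨∅, by rw [Finset.card_empty]; omega, by simp, by simp, by simp⟩
    | insert y Y hyY ih =>
      intro hsub
      obtain ⟨X, hXm, hsX, hYX, hX⟩ := ih ((Finset.subset_insert _ _).trans hsub)
      obtain ⟨X', hXm', hsX', hyX', hX'⟩ := htight y (hsub (Finset.mem_insert_self _ _))
      have hcard : (X ∪ X').card ≤ 2 * m := (Finset.card_union_le _ _).trans (by omega)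
      have hu := hready (X ∪ X') hcard
      have hi := hready (X ∩ X') ((Finset.card_le_card Finset.inter_subset_left).trans (by omega))
      have hsum := Finset.sum_union_inter (s₁ := X) (s₂ := X') (f := f)
      have hNu : (X ∪ X').biUnion nb \ U = (X.biUnion nb \ U) ∪ (X'.biUnion nb \ U) := by
        rw [Finset.union_biUnion, Finset.union_sdiff_distrib]
      have hNi : (X ∩ X').biUnion nb \ U ⊆ (X.biUnion nb \ U) ∩ (X'.biUnion nb \ U) := by
        intro z hz
        simp only [Finset.mem_sdiff, Finset.mem_biUnion, Finset.mem_inter] at hz ⊢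
        obtain ⟨⟨x, hx, hxz⟩, hzU⟩ := hz
        exact ⟨⟨⟨x, hx.1, hxz⟩, hzU⟩, ⟨⟨x, hx.2, hxz⟩, hzU⟩⟩
      have h2 := Finset.card_le_card hNi
      have h3 := Finset.card_union_add_card_inter (X.biUnion nb \ U) (X'.biUnion nb \ U)
      rw [← hNu] at h3
      have heq : ∑ x ∈ X ∪ X', f x = (((X ∪ X').biUnion nb \ U).card : ℤ) := by omega
      refine ⟨X ∪ X', ?_, by simp [hsX, hsX'], ?_, heq⟩
      · by_contra hmX
        exact (hslack _ (by omega) hcard).ne heq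
      · rw [Finset.union_biUnion]
        intro z hz
        rcases Finset.mem_insert.mp hz with rfl | hz
        · exact Finset.mem_union_right _ hyX'
        · exact Finset.mem_union_left _ (hYX hz)
  -- One tight set sees all free neighbours of `s`. Adding `s` raises the demand by at least one but
  -- leaves the free neighbourhood unchanged, a contradiction.
  obtain ⟨X, hXm, hsX, hYX, hX⟩ := hcover _ subset_rfl
  have h1 := hready (insert s X) ((Finset.card_insert_le _ _).trans (by omega))
  rw [Finset.sum_insert hsX, Finset.biUnion_insert, Finset.union_sdiff_distrib,
    Finset.union_eq_right.mpr (fun z hz => Finset.mem_sdiff.mpr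
      ⟨hYX hz, (Finset.mem_sdiff.mp hz).2⟩)] at h1
  omega

/-- The number of children of `x` among `N` for the parent map `π`. -/
def childCount (N : Finset V) (π : V → V) (x : V) : ℕ := (N.filter fun y => π y = x).card

/-- A forest on new vertices `N` with parent map `π`, grown from the occupied set `U`. -/
structure GrownForest (nb : V → Finset V) (m : ℕ) (U : Finset V) (f : V → ℤ) (N : Finset V)
    (π : V → V) : Prop where
  disj : Disjoint N U
  mem_nb : ∀ y ∈ N, y ∈ nb (π y)
  ready : ForestReady nb m (U ∪ N) fun x => f x - childCount N π x

/-- Any part of the new vertices can be released again. -/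
theorem GrownForest.subset {N Q : Finset V} {π : V → V} (h : GrownForest nb m U f N π)
    (hQ : Q ⊆ N) : GrownForest nb m U f Q π := by
  refine ⟨h.disj.mono_left hQ, fun y hy => h.mem_nb y (hQ hy), fun X hX => ?_⟩
  have h1 := h.ready X hX
  have hsum : ∀ M : Finset V, ∑ x ∈ X, childCount M π x = (M.filter fun y => π y ∈ X).card := by
    intro M
    rw [Finset.card_eq_sum_card_fiberwise (f := π) (t := X)]
    · refine Finset.sum_congr rfl fun x hx => ?_
      rw [childCount, Finset.filter_filter]
      congr 1
      ext y
      simp only [Finset.mem_filter]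
      constructor
      · rintro ⟨h1, rfl⟩; exact ⟨h1, hx, rfl⟩
      · rintro ⟨h1, _, h2⟩; exact ⟨h1, h2⟩
    · intro y hy
      exact (Finset.mem_filter.mp hy).2
  simp only [Finset.sum_sub_distrib, ← Nat.cast_sum, hsum] at h1 ⊢
  -- Every released vertex with parent in `X` gives one unit of demand back to `X`, but also becomes
  -- a free neighbour of `X` again.
  have hN : (N.filter fun y => π y ∈ X) = (Q.filter fun y => π y ∈ X) ∪
      ((N \ Q).filter fun y => π y ∈ X) := by
    rw [← Finset.filter_union, Finset.union_sdiff_of_subset hQ]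
  have hdisj : Disjoint (X.biUnion nb \ (U ∪ N)) ((N \ Q).filter fun y => π y ∈ X) := by
    rw [Finset.disjoint_left]
    intro y hy hy'
    simp only [Finset.mem_sdiff, Finset.mem_union, Finset.mem_filter] at hy hy'
    exact hy.2 (Or.inr hy'.1.1)
  have hsub : (X.biUnion nb \ (U ∪ N)) ∪ ((N \ Q).filter fun y => π y ∈ X)
      ⊆ X.biUnion nb \ (U ∪ Q) := by
    intro y hy
    simp only [Finset.mem_sdiff, Finset.mem_union, Finset.mem_filter] at hy ⊢
    rcases hy with ⟨h1, h2⟩ | ⟨⟨h1, h2⟩, h3⟩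
    · exact ⟨h1, fun h => h2 (h.imp_right (@hQ y))⟩
    · refine ⟨Finset.mem_biUnion.mpr ⟨_, h3, h.mem_nb y h1⟩, ?_⟩
      rintro (h4 | h4)
      · exact Finset.disjoint_left.mp h.disj h1 h4
      · exact h2 h4
  have h2 := Finset.card_le_card hsub
  rw [Finset.card_union_of_disjoint hdisj] at h2
  have h3 := Finset.card_union_le (Q.filter fun y => π y ∈ X) ((N \ Q).filter fun y => π y ∈ X)
  rw [← hN] at h3
  omega

theorem childCount_insert_update {N : Finset V} {π : V → V} {y s : V} (hy : y ∉ N) (x : V) :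
    childCount (insert y N) (Function.update π y s) x
      = childCount N π x + if x = s then 1 else 0 := by
  unfold childCount
  rw [Finset.filter_insert, Function.update_self]
  have h1 : (N.filter fun z => Function.update π y s z = x) = N.filter fun z => π z = x := by
    refine Finset.filter_congr fun z hz => ?_
    rw [Function.update_of_ne (ne_of_mem_of_not_mem hz hy)]
  rw [h1]
  by_cases hx : x = s
  · rw [if_pos hx.symm, if_pos hx, Finset.card_insert_of_notMem]
    exact fun h => hy (Finset.mem_filter.mp h).1
  · rw [if_neg (Ne.symm hx), if_neg hx, add_zero]

/-- The slack needed for an extension is provided by `hbig`: a set of at least `m` vertices sees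
more than `cap` vertices, at most `U.card + N.card` of them are occupied, and at most `2 * m`
vertices demand at most `4 * m`. -/
theorem GrownForest.exists_insert (hm : 1 ≤ m) (hf : ∀ x, f x ≤ 2) {N : Finset V} {π : V → V}
    (h : GrownForest nb m U f N π) {cap : ℕ}
    (hbig : ∀ X : Finset V, m ≤ X.card → cap < (X.biUnion nb).card)
    (hcap : U.card + N.card + 4 * m ≤ cap) {s : V} (hs : 1 ≤ f s - childCount N π s) :
    ∃ y, y ∉ N ∧ GrownForest nb m U f (insert y N) (Function.update π y s) := by
  obtain ⟨y, hys, hyU, hready⟩ := h.ready.exists_insert hm (s := s) (fun X hX1 hX2 => by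
    have h1 := hbig X hX1
    have h2 : ∑ x ∈ X, (f x - childCount N π x) ≤ ∑ _x ∈ X, (2 : ℤ) :=
      Finset.sum_le_sum fun x _ => by have := hf x; omega
    rw [Finset.sum_const, nsmul_eq_mul] at h2
    have h3 := Finset.le_card_sdiff (U ∪ N) (X.biUnion nb)
    have h4 := Finset.card_union_le U N
    omega) hs
  rw [Finset.mem_union, not_or] at hyU
  refine ⟨y, hyU.2, ?_, ?_, ?_⟩
  · rw [Finset.disjoint_insert_left]
    exact ⟨hyU.1, h.disj⟩
  · intro z hz
    by_cases hzy : z = y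
    · rw [hzy, Function.update_self]; exact hys
    · rw [Function.update_of_ne hzy]
      exact h.mem_nb z (Finset.mem_of_mem_insert_of_ne hz hzy)
  · rw [Finset.union_insert]
    convert hready using 1
    funext x
    rw [childCount_insert_update hyU.2]
    by_cases hx : x = s
    · subst hx
      rw [Function.update_self, if_pos rfl]
      push_cast
      ring
    · rw [Function.update_of_ne hx, if_neg hx, add_zero]

theorem childCount_eq_add {N N' : Finset V} {π π' : V → V} (h : N ⊆ N')
    (hπ : ∀ y ∈ N, π' y = π y) (x : V) :
    childCount N' π' x = childCount N π x + childCount (N' \ N) π' x := by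
  unfold childCount
  have h1 : (N.filter fun y => π y = x) = N.filter fun y => π' y = x :=
    Finset.filter_congr fun y hy => by rw [hπ y hy]
  rw [h1, ← Finset.card_union_of_disjoint]
  · rw [← Finset.filter_union, Finset.union_sdiff_of_subset h]
  · exact Finset.disjoint_filter_filter Finset.disjoint_sdiff

/-- Give two new children to every vertex of `L`. -/
theorem GrownForest.exists_level (hm : 1 ≤ m) (hf : ∀ x, f x ≤ 2) {N : Finset V} {π : V → V}
    (h : GrownForest nb m U f N π) {cap : ℕ}
    (hbig : ∀ X : Finset V, m ≤ X.card → cap < (X.biUnion nb).card) (L : Finset V)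
    (hcap : U.card + N.card + 2 * L.card + 4 * m ≤ cap)
    (hL : ∀ x ∈ L, f x - childCount N π x = 2) :
    ∃ N' π', GrownForest nb m U f N' π' ∧ N ⊆ N' ∧ (∀ y ∈ N, π' y = π y) ∧
      (∀ y ∈ N' \ N, π' y ∈ L) ∧ N'.card = N.card + 2 * L.card ∧
      ∀ x ∈ L, childCount (N' \ N) π' x = 2 := by
  induction L using Finset.induction_on with
  | empty => exact ⟨N, π, h, subset_rfl, fun _ _ => rfl, by simp, by simp, by simp⟩
  | insert s L hsL ih =>
    rw [Finset.card_insert_of_notMem hsL] at hcap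
    obtain ⟨N', π', h', hNN', hπ', hpar, hcard, hch⟩ := ih (by omega)
      fun x hx => hL x (Finset.mem_insert_of_mem hx)
    have hs0 : childCount (N' \ N) π' s = 0 := by
      unfold childCount
      rw [Finset.card_eq_zero, Finset.filter_eq_empty_iff]
      intro y hy hys
      exact hsL (hys ▸ hpar y hy)
    have hs1 := childCount_eq_add hNN' hπ' s
    have hs2 := hL s (Finset.mem_insert_self _ _)
    obtain ⟨y, hyN, hy⟩ := h'.exists_insert hm hf hbig (by omega) (s := s) (by omega)
    have hs3 := childCount_insert_update (π := π') (s := s) hyN s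
    rw [if_pos rfl] at hs3
    obtain ⟨z, hzN, hz⟩ := hy.exists_insert hm hf hbig
      (by rw [Finset.card_insert_of_notMem hyN]; omega) (s := s) (by omega)
    have hzy : z ≠ y := fun h => hzN (h ▸ Finset.mem_insert_self _ _)
    have hzN' : z ∉ N' := fun h => hzN (Finset.mem_insert_of_mem h)
    have hyN0 : y ∉ N := fun h => hyN (hNN' h)
    have hzN0 : z ∉ N := fun h => hzN' (hNN' h)
    have hsub : N ⊆ insert z (insert y N') :=
      hNN'.trans ((Finset.subset_insert _ _).trans (Finset.subset_insert _ _))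
    have hπ2 : ∀ x ∈ N, Function.update (Function.update π' y s) z s x = π x := by
      intro x hx
      rw [Function.update_of_ne (ne_of_mem_of_not_mem hx hzN0),
        Function.update_of_ne (ne_of_mem_of_not_mem hx hyN0), hπ' x hx]
    refine ⟨insert z (insert y N'), Function.update (Function.update π' y s) z s, hz, hsub, hπ2,
      ?_, ?_, ?_⟩
    · intro x hx
      by_cases hxz : x = z
      · rw [hxz, Function.update_self]; exact Finset.mem_insert_self _ _
      by_cases hxy : x = y
      · rw [hxy, Function.update_of_ne hzy.symm, Function.update_self]
        exact Finset.mem_insert_self _ _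
      · rw [Function.update_of_ne hxz, Function.update_of_ne hxy]
        refine Finset.mem_insert_of_mem (hpar x ?_)
        simpa [hxz, hxy] using hx
    · rw [Finset.card_insert_of_notMem hzN, Finset.card_insert_of_notMem hyN,
        Finset.card_insert_of_notMem hsL]
      omega
    · intro x hx
      have h1 := childCount_eq_add hsub hπ2 x
      rw [childCount_insert_update hzN, childCount_insert_update hyN,
        childCount_eq_add hNN' hπ'] at h1
      by_cases hxs : x = s
      · subst hxs
        simp only [if_true] at h1
        omega
      · have h2 := hch x (Finset.mem_of_mem_insert_of_ne hx hxs)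
        simp only [if_neg hxs] at h1
        omega

end ForestEmbedding

/-! ### Joining terminals by short paths through forests. -/

section Connecting

variable {V : Type*} [DecidableEq V] {G : SimpleGraph V} {nb : V → Finset V} {m : ℕ}
  {U : Finset V} {f : V → ℤ}

/-- Binary forests of depth `h` grown from the set `P`; the leaf `y` belongs to the tree with root
`ρ y`. -/
theorem exists_binary_forest (hm : 1 ≤ m) (hnb : ∀ x y, y ∈ nb x → G.Adj x y)
    (hready : ForestReady nb m U f) (hf : ∀ x, f x ≤ 2)
    (hfresh : ∀ x y, y ∈ nb x → y ∉ U → f y = 2) {P : Finset V} (hP : ∀ p ∈ P, f p = 2)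
    (hPold : ∀ p ∈ P, ∀ x, p ∈ nb x → p ∈ U) {cap : ℕ}
    (hbig : ∀ X : Finset V, m ≤ X.card → cap < (X.biUnion nb).card) (h : ℕ)
    (hcap : U.card + P.card * 2 ^ (h + 1) + 4 * m ≤ cap + 2 * P.card) :
    ∃ N π L, ∃ ρ : V → V, GrownForest nb m U f N π ∧ L ⊆ P ∪ N ∧ Disjoint P N ∧
      (∀ y ∈ N, π y ∈ P ∪ N) ∧ (∀ y ∈ L, f y = 2 ∧ childCount N π y = 0) ∧
      (∀ y ∈ L, ρ y ∈ P) ∧ (∀ p ∈ P, (L.filter fun y => ρ y = p).card = 2 ^ h) ∧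
      -- `Q` is the branch leading to `y`. It is closed under parents up to the root, so keeping
      -- only `Q` charges no vertex except `ρ y` and members of `Q`.
      (∀ y ∈ L, ∃ Q ⊆ N, Q.card ≤ h ∧ y ∈ insert (ρ y) Q ∧
        (∀ z ∈ Q, π z ∈ insert (ρ y) Q) ∧
        ∀ z ∈ insert (ρ y) Q, ReachIn G (insert (ρ y) Q) (ρ y) z) ∧
      -- Each tree has `2 ^ (h + 1) - 2` vertices besides its root.
      N.card + 2 * P.card = P.card * 2 ^ (h + 1) := by
  induction h with
  | zero =>
    refine ⟨∅, id, P, id, ⟨by simp, by simp, by simpa [childCount] using hready⟩, by simp, by simp,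
      by simp, fun y hy => ⟨hP y hy, by simp [childCount]⟩, fun y hy => hy, ?_, ?_, ?_⟩
    · intro p hp
      rw [pow_zero, Finset.card_eq_one]
      exact ⟨p, by ext y; simp only [id, Finset.mem_filter, Finset.mem_singleton]; aesop⟩
    · intro y _
      refine ⟨∅, by simp, by simp, by simp, by simp, fun z hz => ?_⟩
      rw [insert_empty_eq, Finset.mem_singleton] at hz
      rw [hz]
      exact Relation.ReflTransGen.refl
    · simp [mul_comm]
  | succ h ih =>
    have hpow : P.card * 2 ^ (h + 1 + 1) = 2 * (P.card * 2 ^ (h + 1)) := by ring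
    have hPle : 2 * P.card ≤ P.card * 2 ^ (h + 1) := by
      rw [pow_succ]
      nlinarith [Nat.one_le_two_pow (n := h), Nat.zero_le P.card]
    obtain ⟨N, π, L, ρ, hg, hLPN, hPN, hpar, hL, hρ, hfib, hchain, hcard⟩ := ih (by omega)
    have hLcard : L.card = P.card * 2 ^ h := by
      rw [Finset.card_eq_sum_card_fiberwise (f := ρ) (t := P) (fun y hy => hρ y hy),
        Finset.sum_congr rfl hfib, Finset.sum_const, smul_eq_mul]
    have hL2 : 2 * L.card = P.card * 2 ^ (h + 1) := by rw [hLcard]; ring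
    obtain ⟨N', π', hg', hNN', hπ', hpar', hcard', hch⟩ := hg.exists_level hm hf hbig L
      (by omega) (fun x hx => by rw [(hL x hx).1, (hL x hx).2]; simp)
    have hPN' : Disjoint P N' := by
      rw [Finset.disjoint_left]
      intro p hp hpN
      exact Finset.disjoint_left.mp hg'.disj hpN (hPold p hp _ (hg'.mem_nb p hpN))
    have hparN' : ∀ y ∈ N', π' y ∈ P ∪ N := by
      intro y hy
      by_cases hyN : y ∈ N
      · rw [hπ' y hyN]; exact hpar y hyN
      · exact hLPN (hpar' y (Finset.mem_sdiff.mpr ⟨hy, hyN⟩))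
    have hL'N : ∀ y ∈ N' \ N, y ∉ P ∪ N := by
      intro y hy hyPN
      rw [Finset.mem_sdiff] at hy
      rcases Finset.mem_union.mp hyPN with h1 | h1
      · exact Finset.disjoint_left.mp hPN' h1 hy.1
      · exact hy.2 h1
    refine ⟨N', π', N' \ N, fun y => ρ (π' y), hg', fun y hy =>
      Finset.mem_union_right _ (Finset.mem_sdiff.mp hy).1, hPN', fun y hy => ?_, ?_, ?_, ?_, ?_, ?_⟩
    · exact Finset.union_subset_union_right hNN' (hparN' y hy)
    · intro y hy
      have hyN' := (Finset.mem_sdiff.mp hy).1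
      refine ⟨hfresh _ y (hg'.mem_nb y hyN') (Finset.disjoint_left.mp hg'.disj hyN'), ?_⟩
      unfold childCount
      rw [Finset.card_eq_zero, Finset.filter_eq_empty_iff]
      intro z hz hzy
      exact hL'N y hy (hzy ▸ hparN' z hz)
    · exact fun y hy => hρ _ (hpar' y hy)
    · intro p hp
      rw [Finset.card_eq_sum_card_fiberwise (f := π') (t := L.filter fun y => ρ y = p)]
      · rw [Finset.sum_congr rfl (g := fun _ => 2), Finset.sum_const, hfib p hp, smul_eq_mul,
          pow_succ]
        intro x hx
        rw [Finset.mem_filter] at hx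
        rw [← hch x hx.1, childCount, Finset.filter_filter]
        congr 1
        refine Finset.filter_congr fun y _ => ⟨fun h => h.2, fun h => ⟨?_, h⟩⟩
        simp only [h, hx.2]
      · intro y hy
        rw [Finset.mem_coe, Finset.mem_filter] at hy
        exact Finset.mem_filter.mpr ⟨hpar' y hy.1, hy.2⟩
    · intro y hy
      obtain ⟨Q, hQN, hQh, hyQ, hQπ, hreach⟩ := hchain _ (hpar' y hy)
      have hyN' := (Finset.mem_sdiff.mp hy).1
      refine ⟨insert y Q, ?_, (Finset.card_insert_le _ _).trans (by omega), ?_, ?_, ?_⟩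
      · exact Finset.insert_subset hyN' (hQN.trans hNN')
      · exact Finset.mem_insert_of_mem (Finset.mem_insert_self _ _)
      · intro z hz
        rw [Finset.insert_comm]
        rcases Finset.mem_insert.mp hz with rfl | hz
        · exact Finset.mem_insert_of_mem hyQ
        · rw [hπ' z (hQN hz)]
          exact Finset.mem_insert_of_mem (hQπ z hz)
      · rw [Finset.insert_comm]
        intro z hz
        rcases Finset.mem_insert.mp hz with rfl | hz
        · refine ((hreach _ hyQ).mono (Finset.subset_insert _ _)).tail
            ⟨hnb _ _ (hg'.mem_nb z hyN'), ?_, ?_⟩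
          · exact Finset.mem_insert_of_mem hyQ
          · exact Finset.mem_insert_self _ _
        · exact (hreach z hz).mono (Finset.subset_insert _ _)
    · omega

/-- A partially connected vertex set `S`: each of its vertices can reach one of the representatives
in `P`, which still have two free neighbours to their disposal. -/
structure PartialConnection (G : SimpleGraph V) (nb : V → Finset V) (m : ℕ) (U : Finset V)
    (f : V → ℤ) (S P : Finset V) : Prop where
  ready : ForestReady nb m U f
  le_two : ∀ x, f x ≤ 2
  fresh : ∀ x y, y ∈ nb x → y ∉ U → f y = 2
  rep_two : ∀ p ∈ P, f p = 2
  rep_old : ∀ p ∈ P, ∀ x, p ∈ nb x → p ∈ U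
  rep_mem : P ⊆ S
  reach : ∀ x ∈ S, ∃ p ∈ P, ReachIn G S p x

/-- Two of the components can be joined by a short path. -/
theorem PartialConnection.exists_merge (hm : 1 ≤ m) (hnb : ∀ x y, y ∈ nb x → G.Adj x y)
    {S P : Finset V} (hc : PartialConnection G nb m U f S P) {cap : ℕ}
    (hbig : ∀ X : Finset V, m ≤ X.card → cap < (X.biUnion nb).card)
    (hjoin : ∀ X Y : Finset V, m ≤ X.card → m ≤ Y.card → ∃ x ∈ X, ∃ y ∈ Y, G.Adj x y) {h : ℕ}
    (hh : m ≤ 2 ^ h * (P.card / 2))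
    (hcap : U.card + P.card * 2 ^ (h + 1) + 4 * m ≤ cap + 2 * P.card) :
    ∃ Q f' P', PartialConnection G nb m (U ∪ Q) f' (S ∪ Q) P' ∧ Disjoint Q U ∧
      (∀ y ∈ Q, ∃ x, y ∈ nb x) ∧ P'.Nonempty ∧ P'.card + 1 ≤ P.card ∧ Q.card ≤ 2 * h ∧
      ∀ x, x ∉ S ∪ Q → f' x = f x := by
  obtain ⟨N, π, L, ρ, hg, hLPN, hPN, hpar, hL, hρ, hfib, hchain, -⟩ :=
    exists_binary_forest hm hnb hc.ready hc.le_two hc.fresh hc.rep_two hc.rep_old hbig h hcap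
  -- Each half of the representatives roots at least `m` leaves, so some edge joins leaves from
  -- different halves, hence from different trees.
  obtain ⟨P1, hP1, hP1c⟩ := Finset.exists_subset_card_eq (s := P) (n := P.card / 2) (by omega)
  have hLP : ∀ R ⊆ P, (L.filter fun y => ρ y ∈ R).card = R.card * 2 ^ h := by
    intro R hR
    have hmaps : Set.MapsTo ρ (L.filter fun y => ρ y ∈ R) (R : Finset V) :=
      fun y hy => (Finset.mem_filter.mp hy).2
    rw [Finset.card_eq_sum_card_fiberwise hmaps, Finset.sum_congr rfl (g := fun _ => 2 ^ h),
      Finset.sum_const, smul_eq_mul]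
    intro p hp
    rw [← hfib p (hR hp), Finset.filter_filter]
    congr 1
    refine Finset.filter_congr fun y _ => ⟨fun h => h.2, fun h => ⟨?_, h⟩⟩
    rwa [h]
  obtain ⟨y, hy, y', hy', hadj⟩ := hjoin (L.filter fun y => ρ y ∈ P1)
    (L.filter fun y => ρ y ∈ P \ P1) (by rw [hLP P1 hP1, hP1c, mul_comm]; exact hh) (by
      rw [hLP _ Finset.sdiff_subset, Finset.card_sdiff_of_subset hP1, hP1c, mul_comm]
      exact hh.trans (Nat.mul_le_mul_left _ (by omega)))
  rw [Finset.mem_filter] at hy hy'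
  have hρne : ρ y ≠ ρ y' := fun h => (Finset.mem_sdiff.mp hy'.2).2 (h ▸ hy.2)
  obtain ⟨Q, hQN, hQh, hyQ, hQπ, hreach⟩ := hchain y hy.1
  obtain ⟨Q', hQN', hQh', hyQ', hQπ', hreach'⟩ := hchain y' hy'.1
  have hQQ : Q ∪ Q' ⊆ N := Finset.union_subset hQN hQN'
  have hgQ := hg.subset hQQ
  have hρP := hρ y hy.1
  have hρP' := hρ y' hy'.1
  have hparQ : ∀ z ∈ Q ∪ Q', π z = ρ y ∨ π z = ρ y' ∨ π z ∈ Q ∪ Q' := by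
    intro z hz
    rcases Finset.mem_union.mp hz with hz | hz
    · rcases Finset.mem_insert.mp (hQπ z hz) with h1 | h1
      · exact Or.inl h1
      · exact Or.inr (Or.inr (Finset.mem_union_left _ h1))
    · rcases Finset.mem_insert.mp (hQπ' z hz) with h1 | h1
      · exact Or.inr (Or.inl h1)
      · exact Or.inr (Or.inr (Finset.mem_union_right _ h1))
  have hch0 : ∀ x, x ≠ ρ y → x ≠ ρ y' → x ∉ Q ∪ Q' → childCount (Q ∪ Q') π x = 0 := by
    intro x h1 h2 h3
    unfold childCount
    rw [Finset.card_eq_zero, Finset.filter_eq_empty_iff]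
    rintro z hz rfl
    rcases hparQ z hz with h | h | h
    · exact h1 h
    · exact h2 h
    · exact h3 h
  have hsub1 : insert (ρ y) Q ⊆ S ∪ (Q ∪ Q') :=
    Finset.insert_subset (Finset.mem_union_left _ (hc.rep_mem hρP))
      (Finset.subset_union_left.trans Finset.subset_union_right)
  have hsub2 : insert (ρ y') Q' ⊆ S ∪ (Q ∪ Q') :=
    Finset.insert_subset (Finset.mem_union_left _ (hc.rep_mem hρP'))
      (Finset.subset_union_right.trans Finset.subset_union_right)
  have hr1 : ReachIn G (S ∪ (Q ∪ Q')) (ρ y) y := (hreach y hyQ).mono hsub1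
  have hr2 : ReachIn G (S ∪ (Q ∪ Q')) (ρ y') y' := (hreach' y' hyQ').mono hsub2
  have hr3 : ReachIn G (S ∪ (Q ∪ Q')) y y' :=
    Relation.ReflTransGen.single ⟨hadj, hsub1 hyQ, hsub2 hyQ'⟩
  -- All but the two branches is released. The leaf `y` replaces both roots as representative:
  -- having no children, it still has demand 2.
  refine ⟨Q ∪ Q', fun x => f x - childCount (Q ∪ Q') π x,
    insert y (P \ {ρ y, ρ y'}), ⟨hgQ.ready, ?_, ?_, ?_, ?_, ?_, ?_⟩, hgQ.disj, ?_, ?_, ?_, ?_, ?_⟩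
  · intro x
    have := hc.le_two x
    omega
  · intro x z hzx hzU
    rw [Finset.mem_union, not_or] at hzU
    rw [hc.fresh x z hzx hzU.1, hch0 z _ _ hzU.2]
    · simp
    · rintro rfl; exact hzU.1 (hc.rep_old _ hρP _ hzx)
    · rintro rfl; exact hzU.1 (hc.rep_old _ hρP' _ hzx)
  · intro p hp
    rcases Finset.mem_insert.mp hp with rfl | hp
    · have h1 : childCount (Q ∪ Q') π p ≤ childCount N π p :=
        Finset.card_le_card (Finset.filter_subset_filter _ hQQ)
      have h2 := hL p hy.1
      omega
    · simp only [Finset.mem_sdiff, Finset.mem_insert, Finset.mem_singleton, not_or] at hp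
      rw [hc.rep_two p hp.1, hch0 p hp.2.1 hp.2.2]
      · simp
      · exact fun h => Finset.disjoint_left.mp hPN hp.1 (hQQ h)
  · intro p hp x hpx
    rcases Finset.mem_insert.mp hp with rfl | hp
    · rcases Finset.mem_insert.mp hyQ with h1 | h1
      · rw [h1] at hpx ⊢
        exact Finset.mem_union_left _ (hc.rep_old _ hρP x hpx)
      · exact Finset.mem_union_right _ (Finset.mem_union_left _ h1)
    · exact Finset.mem_union_left _ (hc.rep_old p (Finset.mem_sdiff.mp hp).1 x hpx)
  · refine Finset.insert_subset (hsub1 hyQ) ?_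
    exact Finset.sdiff_subset.trans (hc.rep_mem.trans Finset.subset_union_left)
  · intro x hx
    have hyx : (∃ p ∈ P, ReachIn G (S ∪ (Q ∪ Q')) p x) ∨ ReachIn G (S ∪ (Q ∪ Q')) y x := by
      rcases Finset.mem_union.mp hx with hx | hx
      · obtain ⟨p, hp, hpx⟩ := hc.reach x hx
        exact Or.inl ⟨p, hp, hpx.mono Finset.subset_union_left⟩
      · right
        rcases Finset.mem_union.mp hx with hx | hx
        · exact hr1.symm.trans ((hreach x (Finset.mem_insert_of_mem hx)).mono hsub1)
        · exact hr3.trans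
            (hr2.symm.trans ((hreach' x (Finset.mem_insert_of_mem hx)).mono hsub2))
    rcases hyx with ⟨p, hp, hpx⟩ | hyx
    · by_cases h1 : p = ρ y
      · subst h1
        exact ⟨y, Finset.mem_insert_self _ _, hr1.symm.trans hpx⟩
      by_cases h2 : p = ρ y'
      · subst h2
        exact ⟨y, Finset.mem_insert_self _ _, hr3.trans (hr2.symm.trans hpx)⟩
      · exact ⟨p, Finset.mem_insert_of_mem (by simp [hp, h1, h2]), hpx⟩
    · exact ⟨y, Finset.mem_insert_self _ _, hyx⟩
  · exact fun z hz => ⟨_, hgQ.mem_nb z hz⟩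
  · exact Finset.insert_nonempty _ _
  · have h1 := Finset.card_insert_le y (P \ {ρ y, ρ y'})
    have h2 : ({ρ y, ρ y'} : Finset V) ⊆ P := by
      intro z hz
      simp only [Finset.mem_insert, Finset.mem_singleton] at hz
      rcases hz with rfl | rfl <;> assumption
    rw [Finset.card_sdiff_of_subset h2, Finset.card_pair hρne] at h1
    have h3 := Finset.card_le_card h2
    rw [Finset.card_pair hρne] at h3
    omega
  · exact (Finset.card_union_le _ _).trans (by omega)
  · intro x hx
    change f x - (childCount (Q ∪ Q') π x : ℤ) = f x
    rw [hch0 x, Nat.cast_zero, sub_zero]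
    · rintro rfl; exact hx (Finset.mem_union_left _ (hc.rep_mem hρP))
    · rintro rfl; exact hx (Finset.mem_union_left _ (hc.rep_mem hρP'))
    · exact fun h => hx (Finset.mem_union_right _ h)

/-- All components of a partial connection can be joined. -/
theorem PartialConnection.exists_connected (hm : 1 ≤ m) (hnb : ∀ x y, y ∈ nb x → G.Adj x y)
    {cap : ℕ} (hbig : ∀ X : Finset V, m ≤ X.card → cap < (X.biUnion nb).card)
    (hjoin : ∀ X Y : Finset V, m ≤ X.card → m ≤ Y.card → ∃ x ∈ X, ∃ y ∈ Y, G.Adj x y)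
    {depth cost : ℕ → ℕ} (hdepth : ∀ t, 2 ≤ t → m ≤ 2 ^ depth t * (t / 2))
    (hsize : ∀ t, 2 ≤ t → t * 2 ^ (depth t + 1) ≤ 2 * t + 12 * m) (hmono : Monotone cost)
    (hcost : ∀ t, 2 ≤ t → cost (t - 1) + 2 * depth t ≤ cost t) (t : ℕ) {S P : Finset V}
    (hc : PartialConnection G nb m U f S P) (hP : P.Nonempty) (hPt : P.card ≤ t)
    (hcap : U.card + cost t + 16 * m ≤ cap) :
    ∃ Q f', ForestReady nb m (U ∪ Q) f' ∧ (∀ x, f' x ≤ 2) ∧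
      (∀ x y, y ∈ nb x → y ∉ U ∪ Q → f' y = 2) ∧ Disjoint Q U ∧ (∀ y ∈ Q, ∃ x, y ∈ nb x) ∧
      Q.card ≤ cost t ∧ (∀ x, x ∉ S ∪ Q → f' x = f x) ∧
      ∀ x ∈ S ∪ Q, ∀ y ∈ S ∪ Q, ReachIn G (S ∪ Q) x y := by
  induction t generalizing U f S P with
  | zero =>
    have := hP.card_pos
    omega
  | succ t ih =>
    by_cases hPle : P.card ≤ t
    · have h1 : cost t ≤ cost (t + 1) := hmono (Nat.le_succ t)
      obtain ⟨Q, f', h2, h3, h4, h5, h6, h7, h8⟩ := ih hc hP hPle (by omega)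
      exact ⟨Q, f', h2, h3, h4, h5, h6, h7.trans h1, h8⟩
    by_cases ht : t = 0
    · have hP1 : P.card = 1 := by omega
      obtain ⟨p, rfl⟩ := Finset.card_eq_one.mp hP1
      refine ⟨∅, f, by simpa using hc.ready, hc.le_two, by simpa using hc.fresh, by simp, by simp,
        by simp, by simp, ?_⟩
      rw [Finset.union_empty]
      intro x hx y hy
      obtain ⟨p1, hp1, h1⟩ := hc.reach x hx
      obtain ⟨p2, hp2, h2⟩ := hc.reach y hy
      rw [Finset.mem_singleton] at hp1 hp2
      subst hp1 hp2
      exact h1.symm.trans h2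
    · have hPt1 : P.card = t + 1 := by omega
      -- The forest grown in one round takes at most `12 * m` temporary vertices; together with the
      -- reserve `4 * m` for demands this gives the `16 * m` in `hcap`.
      have h1 := hsize (t + 1) (by omega)
      have h2 := hcost (t + 1) (by omega)
      rw [Nat.add_sub_cancel] at h2
      obtain ⟨Q, f', P', hc', hdisj, hQnb, hP', hP'c, hQc, hf'⟩ :=
        hc.exists_merge hm hnb hbig hjoin (h := depth (t + 1))
          (by rw [hPt1]; exact hdepth _ (by omega)) (by rw [hPt1]; omega)
      have hUQ := Finset.card_union_le U Q
      obtain ⟨Q', f'', h3, h4, h5, h6, h7, h8, h9, h10⟩ := ih hc' hP' (by omega) (by omega)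
      rw [Finset.union_assoc] at h3 h5 h9 h10
      rw [Finset.disjoint_union_right] at h6
      refine ⟨Q ∪ Q', f'', h3, h4, h5, ?_, ?_, ?_, ?_, h10⟩
      · rw [Finset.disjoint_union_left]; exact ⟨hdisj, h6.1⟩
      · intro y hy
        rcases Finset.mem_union.mp hy with hy | hy
        exacts [hQnb y hy, h7 y hy]
      · exact (Finset.card_union_le _ _).trans (by omega)
      · intro x hx
        rw [h9 x hx, hf' x]
        intro hx'
        refine hx ?_
        rw [← Finset.union_assoc]
        exact Finset.mem_union_left _ hx'

/-- Disjoint sets of terminals can be connected, each of them inside its own set. -/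
theorem exists_disjoint_connected {κ : Type*} [Fintype κ] [DecidableEq κ] (hm : 1 ≤ m)
    (hnb : ∀ x y, y ∈ nb x → G.Adj x y)
    {cap : ℕ} (hbig : ∀ X : Finset V, m ≤ X.card → cap < (X.biUnion nb).card)
    (hjoin : ∀ X Y : Finset V, m ≤ X.card → m ≤ Y.card → ∃ x ∈ X, ∃ y ∈ Y, G.Adj x y)
    (hexp : ∀ X : Finset V, X.card ≤ 2 * m → 2 * X.card ≤ (X.biUnion nb).card)
    {depth cost : ℕ → ℕ} (hdepth : ∀ t, 2 ≤ t → m ≤ 2 ^ depth t * (t / 2))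
    (hsize : ∀ t, 2 ≤ t → t * 2 ^ (depth t + 1) ≤ 2 * t + 12 * m) (hmono : Monotone cost)
    (hcost : ∀ t, 2 ≤ t → cost (t - 1) + 2 * depth t ≤ cost t) (τ : κ → Finset V)
    (hτ : ∀ i, (τ i).Nonempty) (hτdisj : ∀ i j, i ≠ j → Disjoint (τ i) (τ j))
    (hτnb : ∀ i, ∀ p ∈ τ i, ∀ x, p ∉ nb x)
    (hcap : ∑ i, cost (τ i).card + 16 * m ≤ cap) :
    ∃ S : κ → Finset V, (∀ i, τ i ⊆ S i) ∧ (∀ i, ∀ y ∈ S i, y ∈ τ i ∨ ∃ x, y ∈ nb x) ∧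
      (∀ i j, i ≠ j → Disjoint (S i) (S j)) ∧
      ∀ i, ∀ x ∈ S i, ∀ y ∈ S i, ReachIn G (S i) x y := by
  -- The sets are treated one at a time. Terminals lie outside the range of `nb`, so those not yet
  -- treated are never occupied, and their demand stays 2.
  have key : ∀ J : Finset κ, ∃ (U : Finset V) (f : V → ℤ) (Q : κ → Finset V),
      ForestReady nb m U f ∧ (∀ x, f x ≤ 2) ∧ (∀ x y, y ∈ nb x → y ∉ U → f y = 2) ∧
      (∀ y ∈ U, ∃ x, y ∈ nb x) ∧ U.card ≤ ∑ i ∈ J, cost (τ i).card ∧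
      (∀ i ∉ J, ∀ x ∈ τ i, f x = 2) ∧ (∀ i ∈ J, Q i ⊆ U) ∧
      (∀ i ∈ J, ∀ j ∈ J, i ≠ j → Disjoint (Q i) (Q j)) ∧
      ∀ i ∈ J, ∀ x ∈ τ i ∪ Q i, ∀ y ∈ τ i ∪ Q i, ReachIn G (τ i ∪ Q i) x y := by
    intro J
    induction J using Finset.induction_on with
    | empty =>
      refine ⟨∅, fun _ => 2, fun _ => ∅, fun X hX => ?_, by simp, by simp, by simp, by simp,
        by simp, by simp, by simp, by simp⟩
      have := hexp X hX
      rw [Finset.sum_const, nsmul_eq_mul, Finset.sdiff_empty]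
      omega
    | insert j J hj ih =>
      obtain ⟨U, f, Q, h1, h2, h3, h4, h5, h6, h7, h8, h9⟩ := ih
      have hc : PartialConnection G nb m U f (τ j) (τ j) :=
        ⟨h1, h2, h3, h6 j hj, fun p hp x hpx => absurd hpx (hτnb j p hp x), subset_rfl,
          fun x hx => ⟨x, hx, Relation.ReflTransGen.refl⟩⟩
      have hle : cost (τ j).card + ∑ i ∈ J, cost (τ i).card ≤ ∑ i, cost (τ i).card := by
        rw [← Finset.sum_insert (f := fun i => cost (τ i).card) hj]
        exact Finset.sum_le_sum_of_subset (Finset.subset_univ _)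
      obtain ⟨R, f', k1, k2, k3, k4, k5, k6, k7, k8⟩ :=
        hc.exists_connected hm hnb hbig hjoin hdepth hsize hmono hcost _ (hτ j) le_rfl (by omega)
      have hQne : ∀ i ∈ J, i ≠ j := fun i hi h => hj (h ▸ hi)
      refine ⟨U ∪ R, f', Function.update Q j R, k1, k2, k3, ?_, ?_, ?_, ?_, ?_, ?_⟩
      · intro y hy
        rcases Finset.mem_union.mp hy with hy | hy
        exacts [h4 y hy, k5 y hy]
      · rw [Finset.sum_insert hj]
        exact (Finset.card_union_le _ _).trans (by omega)
      · intro i hi x hx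
        rw [Finset.mem_insert, not_or] at hi
        rw [k7, h6 i hi.2 x hx]
        rw [Finset.mem_union, not_or]
        refine ⟨Finset.disjoint_left.mp (hτdisj i j hi.1) hx, fun hxR => ?_⟩
        obtain ⟨z, hz⟩ := k5 x hxR
        exact hτnb i x hx z hz
      · intro i hi
        rcases Finset.mem_insert.mp hi with rfl | hi
        · rw [Function.update_self]; exact Finset.subset_union_right
        · rw [Function.update_of_ne (hQne i hi)]
          exact (h7 i hi).trans Finset.subset_union_left
      · intro i hi i' hi' hne
        rcases Finset.mem_insert.mp hi with rfl | hiJ <;>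
          rcases Finset.mem_insert.mp hi' with rfl | hiJ'
        · exact absurd rfl hne
        · rw [Function.update_self, Function.update_of_ne (hQne i' hiJ')]
          exact k4.mono_right (h7 i' hiJ')
        · rw [Function.update_self, Function.update_of_ne (hQne i hiJ)]
          exact (k4.mono_right (h7 i hiJ)).symm
        · rw [Function.update_of_ne (hQne i hiJ), Function.update_of_ne (hQne i' hiJ')]
          exact h8 i hiJ i' hiJ' hne
      · intro i hi
        rcases Finset.mem_insert.mp hi with rfl | hi
        · rw [Function.update_self]; exact k8
        · rw [Function.update_of_ne (hQne i hi)]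
          exact h9 i hi
  obtain ⟨U, f, Q, -, -, -, h4, -, -, h7, h8, h9⟩ := key Finset.univ
  have hQnb : ∀ i, ∀ y ∈ Q i, ∃ x, y ∈ nb x := fun i y hy => h4 y (h7 i (Finset.mem_univ _) hy)
  have hτQ : ∀ i j, Disjoint (τ i) (Q j) := by
    intro i j
    rw [Finset.disjoint_left]
    intro x hx hxQ
    obtain ⟨z, hz⟩ := hQnb j x hxQ
    exact hτnb i x hx z hz
  refine ⟨fun i => τ i ∪ Q i, fun i => Finset.subset_union_left, ?_, ?_,
    fun i => h9 i (Finset.mem_univ _)⟩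
  · intro i y hy
    exact (Finset.mem_union.mp hy).imp_right (hQnb i y)
  · intro i j hij
    rw [Finset.disjoint_union_left, Finset.disjoint_union_right, Finset.disjoint_union_right]
    exact ⟨⟨hτdisj i j hij, hτQ i j⟩, (hτQ j i).symm, h8 i (Finset.mem_univ _) j
      (Finset.mem_univ _) hij⟩

end Connecting

/-! ### Trees described by parent maps. -/

section ParentTrees

variable {V : Type*}

/-- The graph in which every vertex other than `r` is joined to its parent. -/
def parentGraph (r : V) (par : V → V) : SimpleGraph V :=
  SimpleGraph.fromRel fun x y => x ≠ r ∧ par x = y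

variable {r : V} {par : V → V} {rank : V → ℕ}

theorem parentGraph_adj (h : ∀ x, x ≠ r → rank (par x) < rank x) {x : V} (hx : x ≠ r) :
    (parentGraph r par).Adj x (par x) := by
  rw [parentGraph, SimpleGraph.fromRel_adj]
  refine ⟨fun hxp => ?_, Or.inl ⟨hx, rfl⟩⟩
  have := h x hx
  rw [← hxp] at this
  omega

/-- Following parents lowers `rank` until `r` is reached, and never leaves a set closed under
parents. Taking `B = univ` gives connectedness; a small `B` locates the path. -/
theorem exists_walk_parentGraph (h : ∀ x, x ≠ r → rank (par x) < rank x) {B : Set V}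
    (hB : ∀ x ∈ B, x ≠ r → par x ∈ B) {v : V} (hv : v ∈ B) :
    ∃ p : (parentGraph r par).Walk v r, ∀ x ∈ p.support, x ∈ B := by
  induction hn : rank v using Nat.strong_induction_on generalizing v with
  | _ n ih =>
    by_cases hvr : v = r
    · subst hvr
      exact ⟨SimpleGraph.Walk.nil, by simpa using hv⟩
    · obtain ⟨p, hp⟩ := ih (rank (par v)) (hn ▸ h v hvr) (hB v hv hvr) rfl
      refine ⟨SimpleGraph.Walk.cons (parentGraph_adj h hvr) p, fun x hx => ?_⟩
      rw [SimpleGraph.Walk.support_cons, List.mem_cons] at hx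
      rcases hx with rfl | hx
      exacts [hv, hp x hx]

/-- A connected graph with at most `|V| - 1` edges is a tree, and every edge here is `s(x, par x)`
for some `x ≠ r`. -/
theorem parentGraph_isTree [Fintype V] (h : ∀ x, x ≠ r → rank (par x) < rank x) :
    (parentGraph r par).IsTree := by
  classical
  have hconn : (parentGraph r par).Connected := by
    rw [SimpleGraph.connected_iff_exists_forall_reachable]
    refine ⟨r, fun v => ?_⟩
    obtain ⟨p, -⟩ := exists_walk_parentGraph (B := Set.univ) h (by simp) (Set.mem_univ v)
    exact p.reachable.symm
  rw [SimpleGraph.isTree_iff_connected_and_card]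
  refine ⟨hconn, le_antisymm ?_ hconn.card_vert_le_card_edgeSet_add_one⟩
  have hsub : (parentGraph r par).edgeSet
      ⊆ ((Finset.univ.erase r).image fun x => s(x, par x) : Finset (Sym2 V)) := by
    intro e
    induction e using Sym2.ind with
    | _ a b =>
      rw [SimpleGraph.mem_edgeSet, parentGraph, SimpleGraph.fromRel_adj]
      rintro ⟨_, ⟨ha, rfl⟩ | ⟨hb, rfl⟩⟩
      · simp only [Finset.coe_image, Set.mem_image, Finset.mem_coe]
        exact ⟨a, by simpa using ha, rfl⟩
      · simp only [Finset.coe_image, Set.mem_image, Finset.mem_coe]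
        exact ⟨b, by simpa using hb, Sym2.eq_swap⟩
  have h1 := Nat.card_mono (Finset.finite_toSet _) hsub
  rw [Nat.card_eq_fintype_card (α := V)]
  have h2 : (((Finset.univ.erase r).image fun x => s(x, par x) : Finset (Sym2 V))).card
      ≤ Fintype.card V - 1 := by
    refine Finset.card_image_le.trans ?_
    rw [Finset.card_erase_of_mem (Finset.mem_univ _), Finset.card_univ]
  have h3 : 0 < Fintype.card V := Fintype.card_pos_iff.mpr ⟨r⟩
  have h4 : Nat.card (((Finset.univ.erase r).image fun x => s(x, par x) : Finset (Sym2 V)))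
      = ((Finset.univ.erase r).image fun x => s(x, par x)).card := by
    rw [Nat.card_eq_fintype_card, Fintype.card_coe]
  have h5 : Nat.card (parentGraph r par).edgeSet ≤ Nat.card
    (((Finset.univ.erase r).image fun x => s(x, par x) : Finset (Sym2 V))) := h1
  omega

/-- Paths in a tree are unique, so `p` is a shortcut of the reversed walk that follows parents
inside `B`. -/
theorem parentGraph_path_support [Fintype V] (h : ∀ x, x ≠ r → rank (par x) < rank x) {B : Set V}
    (hB : ∀ x ∈ B, x ≠ r → par x ∈ B) {v : V} (hv : v ∈ B) (p : (parentGraph r par).Walk r v)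
    (hp : p.IsPath) : ∀ x ∈ p.support, x ∈ B := by
  classical
  obtain ⟨q, hq⟩ := exists_walk_parentGraph h hB hv
  have := (parentGraph_isTree h).isAcyclic.subsingleton_path _ _ |>.elim ⟨p, hp⟩ q.reverse.toPath
  have hpq : p = q.reverse.bypass := congrArg Subtype.val this
  intro x hx
  rw [hpq] at hx
  have h1 := q.reverse.support_bypass_subset_support hx
  rw [SimpleGraph.Walk.support_reverse, List.mem_reverse] at h1
  exact hq x h1

end ParentTrees

/-! ### From disjoint connected sets and connectors to independent trees. -/

/-- Parents in a breadth-first search tree of a connected vertex set. -/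
theorem exists_parent_of_reachIn {V : Type*} {G : SimpleGraph V} {S : Finset V} {u : V}
    (h : ∀ x ∈ S, ReachIn G S x u) :
    ∃ (q : V → V) (ρ : V → ℕ), ∀ x ∈ S, x ≠ u → q x ∈ S ∧ G.Adj x (q x) ∧ ρ (q x) < ρ x := by
  classical
  let H : SimpleGraph V :=
    { Adj := fun a b => G.Adj a b ∧ a ∈ S ∧ b ∈ S
      symm := ⟨fun a b hab => ⟨hab.1.symm, hab.2.2, hab.2.1⟩⟩
      loopless := ⟨fun a ha => G.loopless.irrefl a ha.1⟩ }
  have key : ∀ x, ∃ y, x ∈ S → x ≠ u → y ∈ S ∧ G.Adj x y ∧ H.dist y u < H.dist x u := by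
    intro x
    by_cases hx : x ∈ S ∧ x ≠ u
    · have hreach : H.Reachable x u := by
        rw [SimpleGraph.reachable_iff_reflTransGen]
        exact h x hx.1
      obtain ⟨p, hp⟩ := hreach.exists_walk_length_eq_dist
      cases p with
      | nil => exact absurd rfl hx.2
      | cons hadj p' =>
        refine ⟨_, fun _ _ => ⟨hadj.2.2, hadj.1, ?_⟩⟩
        have := SimpleGraph.dist_le p'
        rw [SimpleGraph.Walk.length_cons] at hp
        omega
    · exact ⟨x, fun h1 h2 => absurd ⟨h1, h2⟩ hx⟩
  choose q hq using key
  exact ⟨q, fun x => H.dist x u, hq⟩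

/-- Disjoint connected sets `S i`, each containing a neighbour of `r`, together with a system of
distinct connectors in `R` for every vertex, yield independent spanning trees. -/
theorem exists_independentSpanningTrees {V : Type*} [Fintype V] {G : SimpleGraph V} {r : V} {k : ℕ}
    (S : Fin k → Finset V) (u : Fin k → V) (R : Finset V) (hu : ∀ i, u i ∈ S i)
    (hru : ∀ i, G.Adj r (u i)) (hrS : ∀ i, r ∉ S i) (hrR : r ∉ R)
    (hRS : ∀ i, Disjoint R (S i)) (hdisj : ∀ i j, i ≠ j → Disjoint (S i) (S j))
    (hconn : ∀ i, ∀ x ∈ S i, ∀ y ∈ S i, ReachIn G (S i) x y)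
    (w : V → Fin k → V)
    (hw : ∀ v i, (∀ x ∈ S i, ¬ G.Adj v x) →
      w v i ∈ R ∧ G.Adj v (w v i) ∧ ∃ x ∈ S i, G.Adj (w v i) x)
    (hwinj : ∀ v i j, i ≠ j → (∀ x ∈ S i, ¬ G.Adj v x) → (∀ x ∈ S j, ¬ G.Adj v x) →
      w v i ≠ w v j) :
    ∃ T : Fin k → SimpleGraph V, IsIndependentSpanningTrees G r T := by
  classical
  choose q ρ hq using fun i => exists_parent_of_reachIn fun x hx => hconn i x hx (u i) (hu i)
  have hnear : ∀ i x, ∃ y, (∃ z ∈ S i, G.Adj x z) → y ∈ S i ∧ G.Adj x y := by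
    intro i x
    by_cases hx : ∃ z ∈ S i, G.Adj x z
    · obtain ⟨z, hz⟩ := hx
      exact ⟨z, fun _ => hz⟩
    · exact ⟨x, fun h => absurd h hx⟩
  choose near hnear using hnear
  let par : Fin k → V → V := fun i x =>
    if x ∈ S i then (if x = u i then r else q i x)
    else if ∃ z ∈ S i, G.Adj x z then near i x else w x i
  let M : Fin k → ℕ := fun i => 1 + ∑ x, ρ i x
  -- The layers are `r`, then `S i` ordered by distance to `u i`, then the vertices touching `S i`,
  -- then the rest. `M i` bounds the rank on `S i`.
  let rank : Fin k → V → ℕ := fun i x =>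
    if x = r then 0 else if x ∈ S i then 1 + ρ i x
    else if ∃ z ∈ S i, G.Adj x z then M i + 1 else M i + 2
  have hparu : ∀ i, par i (u i) = r := fun i => by simp only [par, if_pos (hu i), if_true]
  have hparq : ∀ i x, x ∈ S i → x ≠ u i → par i x = q i x := fun i x hx hxu => by
    simp only [par, if_pos hx, if_neg hxu]
  have hparn : ∀ i x, x ∉ S i → (∃ z ∈ S i, G.Adj x z) → par i x = near i x := fun i x hx hz => by
    simp only [par, if_neg hx, if_pos hz]
  have hparw : ∀ i x, x ∉ S i → (¬ ∃ z ∈ S i, G.Adj x z) → par i x = w x i := fun i x hx hz => by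
    simp only [par, if_neg hx, if_neg hz]
  have hw' : ∀ i x, (¬ ∃ z ∈ S i, G.Adj x z) →
      w x i ∈ R ∧ G.Adj x (w x i) ∧ ∃ z ∈ S i, G.Adj (w x i) z := by
    intro i x hz
    push Not at hz
    exact hw x i hz
  have hne : ∀ i, ∀ x ∈ S i, x ≠ r := fun i x hx h => hrS i (h ▸ hx)
  have hrankS : ∀ i, ∀ x ∈ S i, rank i x = 1 + ρ i x := fun i x hx => by
    simp only [rank, if_neg (hne i x hx), if_pos hx]
  have hρM : ∀ i x, 1 + ρ i x ≤ M i := fun i x =>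
    Nat.add_le_add_left (Finset.single_le_sum (f := ρ i) (fun _ _ => Nat.zero_le _)
      (Finset.mem_univ x)) 1
  have hrank : ∀ i x, x ≠ r → rank i (par i x) < rank i x := by
    intro i x hxr
    by_cases hx : x ∈ S i
    · rw [hrankS i x hx]
      by_cases hxu : x = u i
      · rw [hxu, hparu]
        simp only [rank, if_true]
        omega
      · obtain ⟨h1, -, h2⟩ := hq i x hx hxu
        rw [hparq i x hx hxu, hrankS i _ h1]
        omega
    · by_cases hz : ∃ z ∈ S i, G.Adj x z
      · rw [hparn i x hx hz, hrankS i _ (hnear i x hz).1]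
        have := hρM i (near i x)
        simp only [rank, if_neg hxr, if_neg hx, if_pos hz]
        omega
      · obtain ⟨h1, -, h2⟩ := hw' i x hz
        have h3 : w x i ∉ S i := Finset.disjoint_left.mp (hRS i) h1
        have h4 : w x i ≠ r := fun h => hrR (h ▸ h1)
        rw [hparw i x hx hz]
        simp only [rank, if_neg hxr, if_neg hx, if_neg hz, if_neg h3, if_neg h4, if_pos h2]
        omega
  have hadj : ∀ i x, x ≠ r → G.Adj x (par i x) := by
    intro i x hxr
    by_cases hx : x ∈ S i
    · by_cases hxu : x = u i
      · rw [hxu, hparu]; exact (hru i).symm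
      · rw [hparq i x hx hxu]; exact (hq i x hx hxu).2.1
    · by_cases hz : ∃ z ∈ S i, G.Adj x z
      · rw [hparn i x hx hz]; exact (hnear i x hz).2
      · rw [hparw i x hx hz]; exact (hw' i x hz).2.1
  -- This set contains `v` and is closed under parents, so it contains the `r`–`v` path of tree `i`.
  -- For `i ≠ j` two such sets meet only in `r` and `v`.
  let B : Fin k → V → Set V := fun i v =>
    {x | x = r ∨ x = v ∨ x ∈ S i ∨ ((¬ ∃ z ∈ S i, G.Adj v z) ∧ x = w v i)}
  have hBS : ∀ i v, ∀ x ∈ S i, x ∈ B i v := fun i v x hx => Or.inr (Or.inr (Or.inl hx))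
  have hB : ∀ i v, ∀ x ∈ B i v, x ≠ r → par i x ∈ B i v := by
    intro i v x hxB hxr
    by_cases hx : x ∈ S i
    · by_cases hxu : x = u i
      · rw [hxu, hparu]; exact Or.inl rfl
      · rw [hparq i x hx hxu]; exact hBS i v _ (hq i x hx hxu).1
    · by_cases hz : ∃ z ∈ S i, G.Adj x z
      · rw [hparn i x hx hz]; exact hBS i v _ (hnear i x hz).1
      · rw [hparw i x hx hz]
        rcases hxB with h | rfl | h | ⟨h1, rfl⟩
        · exact absurd h hxr
        · exact Or.inr (Or.inr (Or.inr ⟨hz, rfl⟩))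
        · exact absurd h hx
        · exact absurd (hw' i v h1).2.2 hz
  have hparr : ∀ i x, x ≠ r → par i x = r → x ∈ S i := by
    intro i x hxr hpx
    by_contra hx
    by_cases hz : ∃ z ∈ S i, G.Adj x z
    · rw [hparn i x hx hz] at hpx
      exact hne i _ (hnear i x hz).1 hpx
    · rw [hparw i x hx hz] at hpx
      exact hrR (hpx ▸ (hw' i x hz).1)
  refine ⟨fun i => parentGraph r (par i), ?_, ?_, fun i => parentGraph_isTree (hrank i), ?_⟩
  · intro i j hij
    by_contra hne'
    -- The edge from `u i` to `r` in tree `i` can lie in tree `j` only if `u i ∈ S j`, because only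
    -- vertices of `S j` can have parent `r` there.
    have h1 := parentGraph_adj (hrank i) (hne i _ (hu i))
    rw [hparu] at h1
    simp only at hij
    rw [hij, parentGraph, SimpleGraph.fromRel_adj] at h1
    rcases h1.2 with h2 | h2
    · exact Finset.disjoint_left.mp (hdisj i j hne') (hu i) (hparr j _ h2.1 h2.2)
    · exact h2.1 rfl
  · intro i x y hxy
    rw [parentGraph, SimpleGraph.fromRel_adj] at hxy
    rcases hxy.2 with ⟨h1, rfl⟩ | ⟨h1, rfl⟩
    · exact hadj i x h1
    · exact (hadj i y h1).symm
  · intro i j hij v p p' hp hp' x hx hx'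
    have h1 := parentGraph_path_support (hrank i) (hB i v) (Or.inr (Or.inl rfl)) p hp x hx
    have h2 := parentGraph_path_support (hrank j) (hB j v) (Or.inr (Or.inl rfl)) p' hp' x hx'
    rcases h1 with h1 | h1 | h1 | ⟨h1, rfl⟩
    · exact Or.inl h1
    · exact Or.inr h1
    · rcases h2 with h2 | h2 | h2 | ⟨h2, rfl⟩
      · exact Or.inl h2
      · exact Or.inr h2
      · exact absurd h2 (Finset.disjoint_left.mp (hdisj i j hij) h1)
      · exact absurd h1 (Finset.disjoint_left.mp (hRS i) (hw' j v h2).1)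
    · rcases h2 with h2 | h2 | h2 | ⟨h2, h3⟩
      · exact Or.inl h2
      · exact Or.inr h2
      · exact absurd h2 (Finset.disjoint_left.mp (hRS j) (hw' i v h1).1)
      · push Not at h1 h2
        exact absurd h3 (hwinj v i j hij h1 h2)

/-! ### Exponential moment bounds. -/

section Tails

variable {V ι : Type*} [DecidableEq ι]

theorem prod_ite_one_eq_pow (D : Finset V) (C : Finset ι) (a : ℝ) (f : V → ι) :
    ∏ v ∈ D, (if f v ∈ C then a else 1) = a ^ (D.filter fun v => f v ∈ C).card := by
  rw [← Finset.prod_filter, Finset.prod_const]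

variable [Fintype ι] [Nonempty ι]

/-- The moment factor contributed by one label, bounded by `1 + x ≤ exp x`. The parameter `b` rounds
`a - 1`: the tails below take `a = exp (-1), exp 1, 0` and `b = -1/2, 2, -1`. -/
theorem avg_ite_one_le_exp (C : Finset ι) {a b : ℝ} (hab : a - 1 ≤ b) :
    (∑ j : ι, if j ∈ C then a else 1) / Fintype.card ι
      ≤ Real.exp (b * (C.card / Fintype.card ι)) := by
  have hpos : (0 : ℝ) < Fintype.card ι := by exact_mod_cast Fintype.card_pos
  have hsum : (∑ j : ι, if j ∈ C then a else 1) = Fintype.card ι + (a - 1) * C.card := by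
    have : ∀ j : ι, (if j ∈ C then a else 1) = 1 + if j ∈ C then a - 1 else 0 := by
      intro j; split_ifs <;> ring
    simp_rw [this]
    rw [Finset.sum_add_distrib, Finset.sum_ite_mem, Finset.univ_inter]
    simp only [Finset.sum_const, Finset.card_univ, nsmul_eq_mul]
    ring
  rw [hsum, add_div, div_self hpos.ne', mul_div_assoc]
  refine le_trans ?_ (Real.add_one_le_exp _)
  rw [add_comm]
  gcongr

variable [Fintype V] [DecidableEq V]

/-- Lower tail for the number of vertices of `D` with label in `C`. -/
theorem labelProb_card_lt_le (D : Finset V) (C : Finset ι) (s : ℝ) :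
    labelProb {f : V → ι | ((D.filter fun v => f v ∈ C).card : ℝ) < s}
      ≤ Real.exp (s - D.card * (C.card / Fintype.card ι) / 2) := by
  have h1 := labelProb_prod_ge_le (V := V) D (fun j : ι => if j ∈ C then Real.exp (-1) else 1)
    (fun j => by split_ifs <;> positivity) (Real.exp_pos (-s))
    {f : V → ι | ((D.filter fun v => f v ∈ C).card : ℝ) < s} (by
      intro f hf
      rw [prod_ite_one_eq_pow, ← Real.exp_nat_mul]
      have : ((D.filter fun v => f v ∈ C).card : ℝ) < s := hf
      exact Real.exp_le_exp.mpr (by linarith))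
  refine h1.trans ?_
  rw [div_le_iff₀ (Real.exp_pos _), ← Real.exp_add]
  have he : Real.exp (-1) - 1 ≤ -(1 / 2) := by
    have := Real.exp_neg_one_lt_half
    linarith
  have hnonneg : 0 ≤ (∑ j : ι, if j ∈ C then Real.exp (-1) else 1) / (Fintype.card ι : ℝ) :=
    div_nonneg (Finset.sum_nonneg fun j _ => by split_ifs <;> positivity) (Nat.cast_nonneg _)
  refine (pow_le_pow_left₀ hnonneg (avg_ite_one_le_exp C he) _).trans_eq ?_
  rw [← Real.exp_nat_mul]
  congr 1
  ring

/-- Upper tail for the number of vertices of `D` with label in `C`. -/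
theorem labelProb_lt_card_le (D : Finset V) (C : Finset ι) (s : ℝ) :
    labelProb {f : V → ι | s < ((D.filter fun v => f v ∈ C).card : ℝ)}
      ≤ Real.exp (2 * (D.card * (C.card / Fintype.card ι)) - s) := by
  have h1 := labelProb_prod_ge_le (V := V) D (fun j : ι => if j ∈ C then Real.exp 1 else 1)
    (fun j => by split_ifs <;> positivity) (Real.exp_pos s)
    {f : V → ι | s < ((D.filter fun v => f v ∈ C).card : ℝ)} (by
      intro f hf
      rw [prod_ite_one_eq_pow, ← Real.exp_nat_mul]
      have : s < ((D.filter fun v => f v ∈ C).card : ℝ) := hf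
      exact Real.exp_le_exp.mpr (by linarith))
  refine h1.trans ?_
  rw [div_le_iff₀ (Real.exp_pos _), ← Real.exp_add]
  have he : Real.exp 1 - 1 ≤ 2 := by
    have := Real.exp_one_lt_d9
    linarith
  have hnonneg : 0 ≤ (∑ j : ι, if j ∈ C then Real.exp 1 else 1) / (Fintype.card ι : ℝ) :=
    div_nonneg (Finset.sum_nonneg fun j _ => by split_ifs <;> positivity) (Nat.cast_nonneg _)
  refine (pow_le_pow_left₀ hnonneg (avg_ite_one_le_exp C he) _).trans_eq ?_
  rw [← Real.exp_nat_mul]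
  congr 1
  ring

/-- The probability that no vertex of `D` has a label in `C`. -/
theorem labelProb_forall_notMem_le (D : Finset V) (C : Finset ι) :
    labelProb {f : V → ι | ∀ v ∈ D, f v ∉ C}
      ≤ Real.exp (-(D.card * (C.card / Fintype.card ι))) := by
  have h1 := labelProb_prod_ge_le (V := V) D (fun j : ι => if j ∈ C then 0 else 1)
    (fun j => by split_ifs <;> positivity) one_pos
    {f : V → ι | ∀ v ∈ D, f v ∉ C} (by
      intro f hf
      rw [Finset.prod_congr rfl fun v hv => if_neg (hf v hv), Finset.prod_const_one])
  refine h1.trans ?_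
  rw [div_one]
  have hnonneg : 0 ≤ (∑ j : ι, if j ∈ C then (0 : ℝ) else 1) / (Fintype.card ι : ℝ) :=
    div_nonneg (Finset.sum_nonneg fun j _ => by split_ifs <;> positivity) (Nat.cast_nonneg _)
  refine (pow_le_pow_left₀ hnonneg (avg_ite_one_le_exp C (b := -1) (by norm_num)) _).trans_eq ?_
  rw [← Real.exp_nat_mul]
  congr 1
  ring

end Tails

/-! ### Random splitting and random colouring. -/

section Labellings

variable {V : Type*} [Fintype V] [DecidableEq V] {G : SimpleGraph V} [DecidableRel G.Adj] {d : ℕ}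

/-- The vertices joined to `v` by a walk of length one or two. -/
def twoBall (G : SimpleGraph V) [DecidableRel G.Adj] (v : V) : Finset V :=
  G.neighborFinset v ∪ (G.neighborFinset v).biUnion fun w => G.neighborFinset w

theorem mem_twoBall_comm {v x : V} : x ∈ twoBall G v ↔ v ∈ twoBall G x := by
  have : ∀ v x : V, x ∈ twoBall G v → v ∈ twoBall G x := by
    intro v x h
    simp only [twoBall, Finset.mem_union, Finset.mem_biUnion, SimpleGraph.mem_neighborFinset]
      at h ⊢
    rcases h with h | ⟨w, h1, h2⟩
    · exact Or.inl h.symm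
    · exact Or.inr ⟨w, h2.symm, h1.symm⟩
  exact ⟨this v x, this x v⟩

theorem card_twoBall_le (hreg : G.IsRegularOfDegree d) (v : V) :
    (twoBall G v).card ≤ d + d * d := by
  have hdeg : ∀ v, (G.neighborFinset v).card = d := fun v => by
    rw [G.card_neighborFinset_eq_degree]; exact hreg v
  refine (Finset.card_union_le _ _).trans ?_
  rw [hdeg]
  refine Nat.add_le_add_left ((Finset.card_biUnion_le_card_mul _ _ d fun w _ => (hdeg w).le).trans
    ?_) _
  rw [hdeg]

/-- The local lemma for events attached to the vertices of a regular graph. -/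
theorem exists_label_avoiding {ι : Type*} [Fintype ι] [Nonempty ι]
    (hreg : G.IsRegularOfDegree d) (hd : 1 ≤ d) (B : V → Set (V → ι))
    (hB : ∀ v, DependsOnLabels (B v) (twoBall G v))
    (hp : ∀ v, 16 * (d : ℝ) ^ 4 * labelProb (B v) ≤ 1) : ∃ f : V → ι, ∀ v, f ∉ B v := by
  have hd1 : (1 : ℝ) ≤ d := by exact_mod_cast hd
  have hd4 : (1 : ℝ) ≤ (d : ℝ) ^ 4 := one_le_pow₀ hd1
  -- Interacting events have intersecting two-balls, which leaves at most `(d + d²)² ≤ 4d⁴` of them;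
  -- the value of `p` makes `4pΔ = 1`.
  refine local_lemma B (twoBall G) hB (1 / (16 * (d : ℝ) ^ 4)) (4 * d ^ 4) (fun v => ?_)
    (fun v => ?_) ?_ ?_
  · rw [le_div_iff₀ (by positivity), mul_comm]
    exact hp v
  · have hsub : (Finset.univ.filter fun w => ¬ Disjoint (twoBall G v) (twoBall G w))
        ⊆ (twoBall G v).biUnion (twoBall G) := by
      intro w hw
      rw [Finset.mem_filter, Finset.not_disjoint_iff] at hw
      obtain ⟨x, hx, hxw⟩ := hw.2
      exact Finset.mem_biUnion.mpr ⟨x, hx, mem_twoBall_comm.mp hxw⟩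
    refine (Finset.card_le_card hsub).trans
      ((Finset.card_biUnion_le_card_mul _ _ _ fun x _ => card_twoBall_le hreg x).trans
        ((Nat.mul_le_mul_right _ (card_twoBall_le hreg v)).trans ?_))
    have : d + d * d ≤ 2 * (d * d) := by nlinarith
    calc (d + d * d) * (d + d * d) ≤ (2 * (d * d)) * (2 * (d * d)) := Nat.mul_le_mul this this
      _ = 4 * d ^ 4 := by ring
  · push_cast
    rw [← sub_nonneg]
    have : 1 - 4 * (1 / (16 * (d : ℝ) ^ 4)) * (4 * (d : ℝ) ^ 4) = 0 := by
      field_simp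
      norm_num
    rw [this]
  · rw [← mul_div_assoc, div_lt_one (by positivity)]
    linarith

/-- Two disjoint vertex sets, each with a positive but small proportion in every `D v`. -/
theorem exists_splitting (hreg : G.IsRegularOfDegree d) (hd : 1 ≤ d) {ε : ℝ} (hε : 0 < ε)
    (D : V → Finset V) (hDN : ∀ v, D v ⊆ G.neighborFinset v)
    (hD : ∀ v, ε * d / 2 ≤ (D v).card) {M : ℕ} (hM2 : 2 ≤ M) (hM : 32 ≤ ε * M)
    (hlarge : 48 * (d : ℝ) ^ 4 ≤ Real.exp (ε / (8 * M) * d)) :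
    ∃ A Z : Finset V, Disjoint A Z ∧ ∀ v, ε / (8 * M) * d ≤ (D v ∩ A).card ∧
      ε / (8 * M) * d ≤ (D v ∩ Z).card ∧ ((D v ∩ (A ∪ Z)).card : ℝ) ≤ ε * d / 4 := by
  have : NeZero M := ⟨by omega⟩
  have hM0 : (0 : ℝ) < M := by exact_mod_cast (by omega : 0 < M)
  have hd0 : (0 : ℝ) < d := by exact_mod_cast (by omega : 0 < d)
  have hM1 : (1 : ℝ) ≤ M := by exact_mod_cast (by omega : 1 ≤ M)
  have h01 : (⟨0, by omega⟩ : Fin M) ≠ ⟨1, by omega⟩ := by simp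
  -- Labels `a` and `b` will define `A` and `Z`. Each is expected at least `4γd` times in `D v`, and
  -- the two together at most `εd/16` times. There are three bad events at each vertex, whence `48 =
  -- 3 · 16`.
  set a : Fin M := ⟨0, by omega⟩
  set b : Fin M := ⟨1, by omega⟩
  set γ : ℝ := ε / (8 * M) with hγ
  let E1 : V → Fin M → Set (V → Fin M) := fun v c =>
    {f | (((D v).filter fun x => f x ∈ ({c} : Finset (Fin M))).card : ℝ) < γ * d}
  let E2 : V → Set (V → Fin M) := fun v =>
    {f | ε * d / 4 < (((D v).filter fun x => f x ∈ ({a, b} : Finset (Fin M))).card : ℝ)}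
  have hcount : ∀ (v : V) (C : Finset (Fin M)) (f g : V → Fin M),
      (∀ x ∈ twoBall G v, f x = g x) →
      ((D v).filter fun x => f x ∈ C) = (D v).filter fun x => g x ∈ C := by
    intro v C f g hfg
    refine Finset.filter_congr fun x hx => ?_
    rw [hfg x (Finset.mem_union_left _ (hDN v hx))]
  have hDd : ∀ v, ((D v).card : ℝ) ≤ d := by
    intro v
    have h1 := Finset.card_le_card (hDN v)
    rw [G.card_neighborFinset_eq_degree, hreg v] at h1
    exact_mod_cast h1
  obtain ⟨f, hf⟩ := exists_label_avoiding hreg hd (fun v => (E1 v a ∪ E1 v b) ∪ E2 v) (by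
    intro v f g hfg hf
    rcases hf with (hf | hf) | hf
    · refine Or.inl (Or.inl ?_)
      simp only [E1, Set.mem_ofPred_eq] at hf ⊢
      rwa [← hcount v _ f g hfg]
    · refine Or.inl (Or.inr ?_)
      simp only [E1, Set.mem_ofPred_eq] at hf ⊢
      rwa [← hcount v _ f g hfg]
    · refine Or.inr ?_
      simp only [E2, Set.mem_ofPred_eq] at hf ⊢
      rwa [← hcount v _ f g hfg]) (by
    intro v
    have hE1 : ∀ c, labelProb (E1 v c) ≤ Real.exp (-(γ * d)) := by
      intro c
      refine (labelProb_card_lt_le (D v) {c} (γ * d)).trans (Real.exp_le_exp.mpr ?_)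
      rw [Finset.card_singleton, Fintype.card_fin]
      have h1 : ε * d / 2 * (1 / M) / 2 ≤ (D v).card * (((1 : ℕ) : ℝ) / M) / 2 := by
        rw [Nat.cast_one]
        gcongr
        exact hD v
      have h2 : ε * d / 2 * (1 / M) / 2 = 2 * (γ * d) := by
        rw [hγ]; field_simp; ring
      linarith
    have hE2 : labelProb (E2 v) ≤ Real.exp (-(γ * d)) := by
      refine (labelProb_lt_card_le (D v) {a, b} (ε * d / 4)).trans (Real.exp_le_exp.mpr ?_)
      rw [Finset.card_pair h01, Fintype.card_fin]
      have h1 : (2 : ℝ) / M ≤ ε / 16 := by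
        rw [div_le_div_iff₀ hM0 (by norm_num)]
        linarith
      have h2 : ((D v).card : ℝ) * (((2 : ℕ) : ℝ) / M) ≤ d * (ε / 16) := by
        rw [Nat.cast_ofNat]
        gcongr
        exact_mod_cast hDd v
      have h3 : γ * d ≤ ε / 8 * d := by
        rw [hγ]
        gcongr
        linarith
      linarith
    have h3 : labelProb ((E1 v a ∪ E1 v b) ∪ E2 v) ≤ 3 * Real.exp (-(γ * d)) := by
      have h4 := labelProb_union_le (E1 v a ∪ E1 v b) (E2 v)
      have h5 := labelProb_union_le (E1 v a) (E1 v b)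
      linarith [hE1 a, hE1 b]
    calc 16 * (d : ℝ) ^ 4 * labelProb ((E1 v a ∪ E1 v b) ∪ E2 v)
        ≤ 16 * (d : ℝ) ^ 4 * (3 * Real.exp (-(γ * d))) := by gcongr
      _ = 48 * (d : ℝ) ^ 4 * Real.exp (-(γ * d)) := by ring
      _ ≤ Real.exp (γ * d) * Real.exp (-(γ * d)) := by gcongr
      _ = 1 := by rw [← Real.exp_add]; simp)
  have hfilter : ∀ v (C : Finset (Fin M)),
      D v ∩ (Finset.univ.filter fun x => f x ∈ C) = (D v).filter fun x => f x ∈ C := by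
    intro v C; ext x; simp
  refine ⟨Finset.univ.filter fun x => f x ∈ ({a} : Finset (Fin M)),
    Finset.univ.filter fun x => f x ∈ ({b} : Finset (Fin M)), ?_, fun v => ?_⟩
  · rw [Finset.disjoint_left]
    intro x hx hx'
    simp only [Finset.mem_filter, Finset.mem_univ, true_and, Finset.mem_singleton] at hx hx'
    exact h01 (hx.symm.trans hx')
  · have hfv := hf v
    simp only [Set.mem_union, not_or, E1, E2, Set.mem_ofPred_eq, not_lt] at hfv
    rw [← Finset.filter_or, hfilter, hfilter]
    refine ⟨hfv.1.1, hfv.1.2, ?_⟩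
    refine le_trans (le_of_eq ?_) hfv.2
    congr 2
    rw [← hfilter]
    ext x
    simp

/-- A random colouring of `Z`: every vertex `v` can match its colours `J v` to distinct vertices of
`W v` having a neighbour of the respective colour, and sees few coloured vertices. -/
theorem exists_colouring (hreg : G.IsRegularOfDegree d) (hd : 1 ≤ d) {k N : ℕ} (hkN : k ≤ N)
    (hkd : k ≤ d) (hN : 1 ≤ N) (Z : Finset V) (W : V → Finset V)
    (hWN : ∀ v, W v ⊆ G.neighborFinset v) (J : V → Finset (Fin k)) {s₀ Y₀ s : ℝ} (hs₀ : 0 ≤ s₀)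
    (hW : ∀ v, (J v).card + s₀ ≤ (W v).card)
    (hexp : ∀ X : Finset V, s₀ ≤ X.card →
      Y₀ ≤ (X.biUnion fun x => G.neighborFinset x ∩ Z).card)
    (hs : 32 * (d : ℝ) ^ 4 * Real.exp (2 * (d * (k / N)) - s) ≤ 1)
    (hY : 64 * (d : ℝ) ^ 6 * Real.exp (-(Y₀ / N)) ≤ 1) :
    ∃ τ : Fin k → Finset V, (∀ i, τ i ⊆ Z) ∧ (∀ i j, i ≠ j → Disjoint (τ i) (τ j)) ∧
      (∀ v, ((G.neighborFinset v ∩ Finset.univ.biUnion τ).card : ℝ) ≤ s) ∧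
      ∀ v, ∃ w : Fin k → V, (∀ i ∈ J v, w i ∈ W v ∧ ∃ z ∈ τ i, G.Adj (w i) z) ∧
        ∀ i ∈ J v, ∀ j ∈ J v, i ≠ j → w i ≠ w j := by
  have : NeZero N := ⟨by omega⟩
  have hN0 : (0 : ℝ) < N := by exact_mod_cast hN
  have hd1 : (1 : ℝ) ≤ d := by exact_mod_cast hd
  have hdeg : ∀ v, (G.neighborFinset v).card = d := fun v => by
    rw [G.card_neighborFinset_eq_degree]; exact hreg v
  -- Only `k` of the `N` labels serve as colours; vertices with another label stay uncoloured, which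
  -- keeps the colour classes sparse.
  let col : Fin k ↪ Fin N := Fin.castLEEmb hkN
  let Y : V → Finset V → Finset V := fun v T =>
    (W v \ T).biUnion fun x => G.neighborFinset x ∩ Z
  have hYball : ∀ v T, Y v T ⊆ twoBall G v := by
    intro v T y hy
    simp only [Y, Finset.mem_biUnion, Finset.mem_sdiff, Finset.mem_inter] at hy
    obtain ⟨x, hx, hy⟩ := hy
    exact Finset.mem_union_right _ (Finset.mem_biUnion.mpr ⟨x, hWN v hx.1, hy.1⟩)
  let E1 : V → Set (V → Fin N) := fun v =>
    {f | s < (((G.neighborFinset v).filter fun x => f x ∈ Finset.univ.map col).card : ℝ)}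
  let F : Finset V → Finset (Fin k) → V → Set (V → Fin N) := fun T X v =>
    {f | ∀ y ∈ Y v T, f y ∉ X.map col}
  -- Violations of Hall's condition at `v`: the colours in `X` are seen only from a set `T ⊆ W v` of
  -- size `|X|`, so no vertex of `Z` adjacent to `W v \ T` has a colour in `X`.
  let E2 : V → Set (V → Fin N) := fun v =>
    ⋃ X ∈ (J v).powerset.erase ∅, ⋃ T ∈ (W v).powersetCard X.card, F T X v
  set δ := Real.exp (-(Y₀ / N)) with hδ
  have hδ0 : 0 < δ := Real.exp_pos _
  have hF : ∀ v, ∀ X ∈ (J v).powerset.erase ∅, ∀ T ∈ (W v).powersetCard X.card,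
      labelProb (F T X v) ≤ δ ^ X.card := by
    intro v X hX T hT
    rw [Finset.mem_erase, Finset.mem_powerset] at hX
    rw [Finset.mem_powersetCard] at hT
    refine (labelProb_forall_notMem_le _ _).trans ?_
    rw [hδ, ← Real.exp_nat_mul, Finset.card_map, Fintype.card_fin]
    refine Real.exp_le_exp.mpr ?_
    have h1 : Y₀ ≤ (Y v T).card := by
      refine hexp _ ?_
      rw [Finset.card_sdiff_of_subset hT.1, Nat.cast_sub (Finset.card_le_card hT.1), hT.2]
      have h2 := hW v
      have h3 : (X.card : ℝ) ≤ (J v).card := by exact_mod_cast Finset.card_le_card hX.2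
      linarith
    have h2 : (X.card : ℝ) * (Y₀ / N) ≤ (Y v T).card * (X.card / N) := by
      rw [mul_div_assoc', mul_div_assoc', mul_comm]
      gcongr
    linarith
  -- There are at most `d^|X|` choices of `T`, each of probability at most `δ^|X|`. Summing
  -- `(dδ)^|X|` over nonempty `X` gives at most `(1 + dδ)^d - 1 ≤ exp (d²δ) - 1 ≤ 2d²δ`.
  have hE2 : ∀ v, labelProb (E2 v) ≤ 2 * ((d : ℝ) ^ 2 * δ) := by
    intro v
    have hWd : (W v).card ≤ d := (Finset.card_le_card (hWN v)).trans_eq (hdeg v)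
    have h1 : labelProb (E2 v) ≤ ∑ X ∈ (J v).powerset.erase ∅, (d * δ) ^ X.card := by
      refine (labelProb_iUnion_le _ _).trans (Finset.sum_le_sum fun X hX => ?_)
      refine (labelProb_iUnion_le _ _).trans ((Finset.sum_le_sum (hF v X hX)).trans ?_)
      rw [Finset.sum_const, nsmul_eq_mul, Finset.card_powersetCard, mul_pow]
      gcongr
      have h2 : (W v).card.choose X.card ≤ d ^ X.card :=
        (Nat.choose_le_pow _ _).trans (Nat.pow_le_pow_left hWd _)
      exact_mod_cast h2
    have h2 : ∑ X ∈ (J v).powerset, (d * δ) ^ X.card = (d * δ + 1) ^ (J v).card := by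
      have := Finset.prod_add (fun _ : Fin k => d * δ) (fun _ => 1) (J v)
      simp only [Finset.prod_const, one_pow, mul_one] at this
      exact this.symm
    have h3 := Finset.add_sum_erase (J v).powerset (fun X : Finset (Fin k) => (d * δ) ^ X.card)
      (Finset.empty_mem_powerset _)
    simp only [Finset.card_empty, pow_zero] at h3
    have hJd : (J v).card ≤ d := ((Finset.card_le_univ _).trans_eq (Fintype.card_fin k)).trans hkd
    have h4 : (d * δ + 1) ^ (J v).card ≤ Real.exp ((d : ℝ) ^ 2 * δ) := by
      calc (d * δ + 1) ^ (J v).card ≤ (d * δ + 1) ^ d :=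
            pow_le_pow_right₀ (by nlinarith) hJd
        _ ≤ Real.exp (d * δ) ^ d := by
            gcongr
            exact Real.add_one_le_exp _
        _ = Real.exp ((d : ℝ) ^ 2 * δ) := by rw [← Real.exp_nat_mul]; congr 1; ring
    have h5 : (d : ℝ) ^ 2 * δ ≤ 1 := by
      have h6 : (d : ℝ) ^ 2 ≤ (d : ℝ) ^ 6 := pow_le_pow_right₀ hd1 (by norm_num)
      nlinarith
    have h6 : Real.exp ((d : ℝ) ^ 2 * δ) ≤ 1 + 2 * ((d : ℝ) ^ 2 * δ) := by
      have h7 := Real.abs_exp_sub_one_le (x := (d : ℝ) ^ 2 * δ) (by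
        rwa [abs_of_nonneg (by positivity)])
      rw [abs_of_nonneg (a := (d : ℝ) ^ 2 * δ) (by positivity)] at h7
      linarith [le_of_abs_le h7]
    linarith
  have hE1 : ∀ v, labelProb (E1 v) ≤ Real.exp (2 * (d * (k / N)) - s) := by
    intro v
    refine (labelProb_lt_card_le (G.neighborFinset v) (Finset.univ.map col) s).trans_eq ?_
    rw [hdeg, Finset.card_map, Finset.card_univ, Fintype.card_fin, Fintype.card_fin]
  obtain ⟨f, hf⟩ := exists_label_avoiding hreg hd (fun v => E1 v ∪ E2 v) (by
    intro v f g hfg hf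
    rcases hf with hf | hf
    · left
      simp only [E1, Set.mem_ofPred_eq] at hf ⊢
      convert hf using 3
      refine Finset.filter_congr fun x hx => ?_
      rw [hfg x (Finset.mem_union_left _ hx)]
    · right
      simp only [E2, Set.mem_iUnion] at hf ⊢
      obtain ⟨X, hX, T, hT, hfT⟩ := hf
      refine ⟨X, hX, T, hT, fun y hy => ?_⟩
      rw [← hfg y (hYball v T hy)]
      exact hfT y hy) (by
    intro v
    have h1 := labelProb_union_le (E1 v) (E2 v)
    have h2 : 16 * (d : ℝ) ^ 4 * labelProb (E1 v ∪ E2 v)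
        ≤ 16 * (d : ℝ) ^ 4 * (Real.exp (2 * (d * (k / N)) - s) + 2 * ((d : ℝ) ^ 2 * δ)) := by
      gcongr
      linarith [hE1 v, hE2 v]
    nlinarith)
  refine ⟨fun i => Z.filter fun z => f z = col i, fun i => Finset.filter_subset _ _, ?_, ?_, ?_⟩
  · intro i j hij
    rw [Finset.disjoint_left]
    intro x hx hx'
    rw [Finset.mem_filter] at hx hx'
    exact hij (col.injective (hx.2.symm.trans hx'.2))
  · intro v
    have h1 := hf v
    simp only [Set.mem_union, not_or, E1, Set.mem_ofPred_eq, not_lt] at h1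
    refine le_trans ?_ h1.1
    norm_cast
    refine Finset.card_le_card fun x hx => ?_
    simp only [Finset.mem_inter, Finset.mem_biUnion, Finset.mem_univ, true_and,
      Finset.mem_filter, Finset.mem_map] at hx ⊢
    obtain ⟨h1, i, -, h2⟩ := hx
    exact ⟨h1, i, h2.symm⟩
  · intro v
    let t : {i // i ∈ J v} → Finset V := fun i =>
      (W v).filter fun x => ∃ z ∈ Z, f z = col i ∧ G.Adj x z
    have hall : ∀ X : Finset {i // i ∈ J v}, X.card ≤ (X.biUnion t).card := by
      intro X
      by_contra hlt
      push Not at hlt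
      have hsub : X.biUnion t ⊆ W v := by
        intro x hx
        obtain ⟨i, -, hi⟩ := Finset.mem_biUnion.mp hx
        exact (Finset.mem_filter.mp hi).1
      set X' : Finset (Fin k) := X.map (Function.Embedding.subtype _) with hX'
      have hX'J : X' ⊆ J v := by
        intro i hi
        obtain ⟨j, -, rfl⟩ := Finset.mem_map.mp hi
        exact j.2
      have hX'W : X.card ≤ (W v).card := by
        have h1 := hW v
        have h2 := Finset.card_le_card hX'J
        rw [Finset.card_map] at h2
        have h3 : ((J v).card : ℝ) ≤ (W v).card := by linarith
        exact h2.trans (by exact_mod_cast h3)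
      -- The deficient neighbourhood is enlarged to size exactly `|X|`, to match the events in `E2`.
      obtain ⟨T, hT1, hT2, hT3⟩ := Finset.exists_subsuperset_card_eq hsub hlt.le hX'W
      refine (hf v) (Or.inr ?_)
      simp only [E2, Set.mem_iUnion]
      refine ⟨X', ?_, T, ?_, ?_⟩
      · rw [Finset.mem_erase, Finset.mem_powerset]
        refine ⟨fun h => ?_, hX'J⟩
        have : X.card = 0 := by rw [← Finset.card_map (Function.Embedding.subtype _), ← hX', h]; rfl
        omega
      · rw [Finset.mem_powersetCard, Finset.card_map]
        exact ⟨hT2, hT3⟩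
      · intro y hy hyX
        simp only [Y, Finset.mem_biUnion, Finset.mem_sdiff, Finset.mem_inter,
          SimpleGraph.mem_neighborFinset] at hy
        obtain ⟨x, ⟨hxW, hxT⟩, hxy, hyZ⟩ := hy
        obtain ⟨i, hi, hiy⟩ := Finset.mem_map.mp hyX
        obtain ⟨j, hj, rfl⟩ := Finset.mem_map.mp hi
        refine hxT (hT1 (Finset.mem_biUnion.mpr ⟨j, hj, ?_⟩))
        exact Finset.mem_filter.mpr ⟨hxW, y, hyZ, hiy.symm, hxy⟩
    obtain ⟨w, hwinj, hw⟩ := (Finset.all_card_le_biUnion_card_iff_exists_injective t).mp hall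
    refine ⟨fun i => if h : i ∈ J v then w ⟨i, h⟩ else v, ?_, ?_⟩
    · intro i hi
      simp only [dif_pos hi]
      have h1 := Finset.mem_filter.mp (hw ⟨i, hi⟩)
      obtain ⟨h2, z, hz, hzi, hadj⟩ := h1
      exact ⟨h2, z, Finset.mem_filter.mpr ⟨hz, hzi⟩, hadj⟩
    · intro i hi j hj hij heq
      simp only [dif_pos hi, dif_pos hj] at heq
      exact hij (congrArg Subtype.val (hwinj heq))

end Labellings

/-! ### Expansion properties obtained from mixing. -/

section Spectral

variable {V : Type*} [Fintype V] [DecidableEq V] {G : SimpleGraph V} [DecidableRel G.Adj]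
  {n d : ℕ} {lam : ℝ}

/-- If every vertex of `X` has a positive proportion of its neighbours in `B`, then `X` expands
into `B`. -/
theorem IsNDLambdaGraph.le_card_biUnion (h : IsNDLambdaGraph G n d lam) (hn : 2 ≤ n) (hd : 1 ≤ d)
    (hlam0 : 0 < lam) (hlam : lam < d) {γ : ℝ} (hγ : 0 < γ) {X B : Finset V}
    (hX : ∀ x ∈ X, γ * d ≤ (G.neighborFinset x ∩ B).card) {t : ℝ} (ht1 : t ≤ γ * n / 2)
    (ht2 : t ≤ X.card * (γ * d / (2 * lam)) ^ 2) :
    t ≤ (X.biUnion fun x => G.neighborFinset x ∩ B).card := by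
  set Y := X.biUnion fun x => G.neighborFinset x ∩ B with hY
  by_contra hlt
  push Not at hlt
  have hn0 : (0 : ℝ) < n := by exact_mod_cast (by omega : 0 < n)
  have hd0 : (0 : ℝ) < d := by exact_mod_cast (by omega : 0 < d)
  have hX0 : (0 : ℝ) < X.card := by
    by_contra h0
    have : (X.card : ℝ) = 0 := le_antisymm (not_lt.mp h0) (Nat.cast_nonneg _)
    rw [this, zero_mul] at ht2
    linarith [Nat.cast_nonneg (α := ℝ) Y.card]
  have h1 : (X.card : ℝ) * (γ * d) ≤ ∑ x ∈ X, ((G.neighborFinset x ∩ Y).card : ℝ) := by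
    rw [← nsmul_eq_mul, ← Finset.sum_const]
    refine Finset.sum_le_sum fun x hx => (hX x hx).trans ?_
    norm_cast
    refine Finset.card_le_card fun y hy => Finset.mem_inter.mpr ⟨(Finset.mem_inter.mp hy).1, ?_⟩
    exact Finset.mem_biUnion.mpr ⟨x, hx, hy⟩
  -- At least `γd|X|` edges run from `X` to `Y`. If `Y` is small, the main term accounts for at most
  -- half of them, so the error `λ√(|X||Y|)` must cover the other half.
  have h2 := le_of_abs_le (h.mixing hn hlam X Y)
  have h3 : d / n * ((X.card : ℝ) * Y.card) ≤ X.card * (γ * d) / 2 := by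
    have h4 : (Y.card : ℝ) ≤ γ * n / 2 := (hlt.trans_le ht1).le
    calc d / n * ((X.card : ℝ) * Y.card) ≤ d / n * ((X.card : ℝ) * (γ * n / 2)) := by gcongr
      _ = X.card * (γ * d) / 2 := by field_simp
  have hsx : 0 < √(X.card : ℝ) := Real.sqrt_pos.mpr hX0
  have h5 : √(X.card : ℝ) * √X.card = X.card := Real.mul_self_sqrt hX0.le
  have h6 : √(X.card : ℝ) * (γ * d / (2 * lam)) ≤ √Y.card := by
    have h7 : √(X.card : ℝ) * (√X.card * (γ * d) / 2) ≤ √(X.card : ℝ) * (lam * √Y.card) := by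
      have : √(X.card : ℝ) * (√X.card * (γ * d) / 2) = X.card * (γ * d) / 2 := by
        rw [← mul_div_assoc, ← mul_assoc, h5]
      rw [this]
      linarith
    have h8 := le_of_mul_le_mul_left h7 hsx
    rw [mul_div_assoc', div_le_iff₀ (by positivity)]
    linarith
  have h9 : (√(X.card : ℝ) * (γ * d / (2 * lam))) ^ 2 ≤ (√Y.card) ^ 2 := by
    gcongr
  rw [mul_pow, Real.sq_sqrt hX0.le, Real.sq_sqrt (Nat.cast_nonneg _)] at h9
  linarith

/-- Large vertex sets are joined by an edge. -/
theorem IsNDLambdaGraph.exists_adj (h : IsNDLambdaGraph G n d lam) (hn : 2 ≤ n) (hd : 1 ≤ d)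
    (hlam0 : 0 < lam) (hlam : lam < d) {X Y : Finset V} (hX : lam * n / d < X.card)
    (hY : lam * n / d < Y.card) : ∃ x ∈ X, ∃ y ∈ Y, G.Adj x y := by
  by_contra hcon
  push Not at hcon
  have hn0 : (0 : ℝ) < n := by exact_mod_cast (by omega : 0 < n)
  have hd0 : (0 : ℝ) < d := by exact_mod_cast (by omega : 0 < d)
  have h1 := neg_le_of_abs_le (h.mixing hn hlam X Y)
  have h2 : ∑ x ∈ X, ((G.neighborFinset x ∩ Y).card : ℝ) = 0 := by
    refine Finset.sum_eq_zero fun x hx => ?_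
    rw [Nat.cast_eq_zero, Finset.card_eq_zero, Finset.eq_empty_iff_forall_notMem]
    intro y hy
    rw [Finset.mem_inter, SimpleGraph.mem_neighborFinset] at hy
    exact hcon x hx y hy.2 hy.1
  rw [h2, zero_sub, neg_le_neg_iff] at h1
  have ht : 0 < lam * n / d := by positivity
  have hX0 : (0 : ℝ) < X.card := ht.trans hX
  have hY0 : (0 : ℝ) < Y.card := ht.trans hY
  have h3 : d / n * ((X.card : ℝ) * Y.card)
      = d / n * (√X.card * √Y.card) * (√X.card * √Y.card) := by
    rw [mul_assoc, mul_mul_mul_comm, Real.mul_self_sqrt hX0.le, Real.mul_self_sqrt hY0.le]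
  rw [h3] at h1
  have hpos : 0 < √(X.card : ℝ) * √Y.card := by positivity
  have h4 := le_of_mul_le_mul_right h1 hpos
  have h5 : lam * n / d < √(X.card : ℝ) * √Y.card := by
    rw [← Real.sqrt_mul hX0.le, Real.lt_sqrt ht.le, sq]
    exact mul_lt_mul'' hX hY ht.le ht.le
  have h6 : lam < d / n * (√(X.card : ℝ) * √Y.card) := by
    calc lam = d / n * (lam * n / d) := by field_simp
      _ < _ := by gcongr
  linarith

/-- The trivial lower bound for the second eigenvalue. -/
theorem IsNDLambdaGraph.sqrt_le (h : IsNDLambdaGraph G n d lam) (hn : 2 ≤ n) (hd : 1 ≤ d)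
    (hlam : lam < d) (hdn : 2 * d ≤ n) : √d ≤ 2 * lam := by
  have hn0 : (0 : ℝ) < n := by exact_mod_cast (by omega : 0 < n)
  have hd0 : (0 : ℝ) < d := by exact_mod_cast (by omega : 0 < d)
  have hcard := h.card_eq
  obtain ⟨v⟩ : Nonempty V := Fintype.card_pos_iff.mp (by omega)
  -- Between `v` and its neighbourhood there are `d` edges; the main term `d²/n` is at most `d/2`,
  -- so `λ√d ≥ d/2`.
  have h1 := le_of_abs_le (h.mixing hn hlam {v} (G.neighborFinset v))
  rw [Finset.sum_singleton, Finset.inter_self, G.card_neighborFinset_eq_degree, h.regular v,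
    Finset.card_singleton, Nat.cast_one, Real.sqrt_one, one_mul, one_mul] at h1
  have h2 : (d : ℝ) / n ≤ 1 / 2 := by
    rw [div_le_div_iff₀ hn0 two_pos]
    have : (2 : ℝ) * d ≤ n := by exact_mod_cast hdn
    linarith
  have h3 : (d : ℝ) / n * d ≤ 1 / 2 * d := by gcongr
  have hs : 0 < √(d : ℝ) := Real.sqrt_pos.mpr hd0
  have h4 : √(d : ℝ) * √d = d := Real.mul_self_sqrt hd0.le
  have h5 : √(d : ℝ) * √d ≤ (2 * lam) * √d := by linarith
  exact le_of_mul_le_mul_right h5 hs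

end Spectral

/-! ### The cost of connecting `t` terminals. -/

/-- The depths of the binary forests used to connect `t` terminals, and their total cost. -/
theorem exists_depth_cost {m : ℕ} (hm : 1 ≤ m) {a L : ℝ} (ha : 0 < a) (hL0 : 0 ≤ L)
    (hL : Real.log (3 * m / a) ≤ L) :
    ∃ depth cost : ℕ → ℕ, (∀ t, 2 ≤ t → m ≤ 2 ^ depth t * (t / 2)) ∧
      (∀ t, 2 ≤ t → t * 2 ^ (depth t + 1) ≤ 2 * t + 12 * m) ∧ Monotone cost ∧
      (∀ t, 2 ≤ t → cost (t - 1) + 2 * depth t ≤ cost t) ∧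
      ∀ t, (cost t : ℝ) ≤ (8 + 3 * L) * t + 6 * a := by
  have hex : ∀ t, ∃ h, 2 ≤ t → m ≤ 2 ^ h * (t / 2) ∧
      (h = 0 ∨ 2 ^ (h - 1) * (t / 2) < m) := by
    intro t
    by_cases ht : 2 ≤ t
    · classical
      have hE : ∃ h, m ≤ 2 ^ h * (t / 2) :=
        ⟨m, (Nat.lt_two_pow_self (n := m)).le.trans (Nat.le_mul_of_pos_right _ (by omega))⟩
      refine ⟨Nat.find hE, fun _ => ⟨Nat.find_spec hE, ?_⟩⟩
      by_cases h0 : Nat.find hE = 0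
      · exact Or.inl h0
      · exact Or.inr (not_le.mp (Nat.find_min hE (Nat.sub_lt (Nat.pos_of_ne_zero h0) one_pos)))
    · exact ⟨0, fun h => absurd h ht⟩
  choose depth hdepth using hex
  -- Minimality of the depth gives `2 ^ (depth t - 1) ≤ (3m/a)(a/t)`. The bounds `log (3m/a) ≤ L`,
  -- `log (a/t) ≤ 2√(a/t)` and `log 2 ≥ 2/3` then produce the constants.
  have hreal : ∀ t, 2 ≤ t → 2 * (depth t : ℝ) ≤ 2 + 3 * L + 6 * √(a / t) := by
    intro t ht
    have ht0 : (0 : ℝ) < t := by exact_mod_cast (by omega : 0 < t)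
    have hm0 : (0 : ℝ) < m := by exact_mod_cast hm
    rcases (hdepth t ht).2 with h0 | h0
    · rw [h0]
      have := Real.sqrt_nonneg (a / t)
      push_cast
      linarith
    · have hpos : 1 ≤ depth t ∨ depth t = 0 := by omega
      rcases hpos with hpos | hpos
      swap
      · rw [hpos]
        have := Real.sqrt_nonneg (a / t)
        push_cast
        linarith
      have h1 : 2 ^ (depth t - 1) * t ≤ 3 * m := by
        calc 2 ^ (depth t - 1) * t ≤ 2 ^ (depth t - 1) * (3 * (t / 2)) :=
              Nat.mul_le_mul_left _ (by omega)
          _ = 3 * (2 ^ (depth t - 1) * (t / 2)) := by ring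
          _ ≤ 3 * m := by omega
      have h2 : (2 : ℝ) ^ (depth t - 1) ≤ 3 * m / a * (a / t) := by
        have h3 : (2 : ℝ) ^ (depth t - 1) * t ≤ 3 * m := by exact_mod_cast h1
        have h4 : 3 * (m : ℝ) / a * (a / t) = 3 * m / t := by field_simp
        rw [h4, le_div_iff₀ ht0]
        exact h3
      have h3 := Real.log_le_log (by positivity) h2
      have hs : 0 < √(a / t) := Real.sqrt_pos.mpr (by positivity)
      rw [Real.log_pow, Real.log_mul (by positivity) (by positivity)] at h3
      have h4 : Real.log (a / t) ≤ 2 * √(a / t) := by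
        rw [← Real.sq_sqrt (show 0 ≤ a / t by positivity), Real.log_pow,
          Real.sqrt_sq hs.le]
        push_cast
        linarith [Real.log_le_sub_one_of_pos hs]
      have h5 : ((depth t - 1 : ℕ) : ℝ) = depth t - 1 := by
        rw [Nat.cast_sub hpos, Nat.cast_one]
      rw [h5] at h3
      have h6 : ((depth t : ℝ) - 1) * (2 / 3) ≤ (depth t - 1) * Real.log 2 := by
        have h7 : (1 : ℝ) ≤ depth t := by exact_mod_cast hpos
        have h8 := Real.log_two_gt_d9
        refine mul_le_mul_of_nonneg_left ?_ (by linarith)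
        linarith
      linarith
  refine ⟨depth, fun T => ∑ t ∈ Finset.range (T + 1), if 2 ≤ t then 2 * depth t else 0,
    fun t ht => (hdepth t ht).1, ?_, ?_, ?_, ?_⟩
  · intro t ht
    rcases (hdepth t ht).2 with h0 | h0
    · rw [h0]; omega
    · by_cases hz : depth t = 0
      · rw [hz]; omega
      have h1 : 2 ^ (depth t + 1) = 4 * 2 ^ (depth t - 1) := by
        obtain ⟨j, hj⟩ := Nat.exists_eq_succ_of_ne_zero hz
        rw [hj, Nat.succ_eq_add_one, Nat.add_sub_cancel]
        ring
      calc t * 2 ^ (depth t + 1) = 4 * (2 ^ (depth t - 1) * t) := by rw [h1]; ring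
        _ ≤ 4 * (2 ^ (depth t - 1) * (3 * (t / 2))) := by gcongr; omega
        _ = 12 * (2 ^ (depth t - 1) * (t / 2)) := by ring
        _ ≤ 2 * t + 12 * m := by omega
  · intro s t hst
    exact Finset.sum_le_sum_of_subset (Finset.range_mono (by omega))
  · intro t ht
    simp only
    rw [show t - 1 + 1 = t by omega, Finset.sum_range_succ, if_pos ht]
  · intro T
    have hb : ∀ T : ℕ, ((∑ t ∈ Finset.range (T + 1), if 2 ≤ t then 2 * depth t else 0 : ℕ) : ℝ)
        ≤ (2 + 3 * L) * T + 12 * √(a * T) := by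
      intro T
      induction T with
      | zero => simp
      | succ T ih =>
        rw [Finset.sum_range_succ, Nat.cast_add]
        have hT : (0 : ℝ) < ((T + 1 : ℕ) : ℝ) := by positivity
        have hstep : ((if 2 ≤ T + 1 then 2 * depth (T + 1) else 0 : ℕ) : ℝ)
            ≤ 2 + 3 * L + 6 * √(a / ((T + 1 : ℕ) : ℝ)) := by
          split_ifs with h
          · have := hreal (T + 1) h
            push_cast at this ⊢
            exact this
          · have := Real.sqrt_nonneg (a / ((T + 1 : ℕ) : ℝ))
            push_cast at this ⊢
            linarith
        have hsq : √(a / ((T + 1 : ℕ) : ℝ)) ≤ 2 * (√(a * ((T + 1 : ℕ) : ℝ)) - √(a * T)) := by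
          rw [Real.sqrt_div ha.le, Real.sqrt_mul ha.le, Real.sqrt_mul ha.le, ← mul_sub]
          set p := √(((T + 1 : ℕ) : ℝ)) with hp
          set q := √(T : ℝ) with hq
          have hp0 : 0 < p := Real.sqrt_pos.mpr hT
          have hp2 : p ^ 2 = T + 1 := by rw [hp, Real.sq_sqrt hT.le]; push_cast; ring
          have hq2 : q ^ 2 = T := by rw [hq, Real.sq_sqrt (Nat.cast_nonneg _)]
          have hsa := Real.sqrt_nonneg a
          rw [div_le_iff₀ hp0]
          have h1 : 1 ≤ 2 * (p - q) * p := by nlinarith [sq_nonneg (p - q)]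
          calc √a = √a * 1 := (mul_one _).symm
            _ ≤ √a * (2 * (p - q) * p) := by gcongr
            _ = 2 * (√a * (p - q)) * p := by ring
        have hcast : ((T + 1 : ℕ) : ℝ) = T + 1 := by push_cast; ring
        have : (2 + 3 * L) * ((T + 1 : ℕ) : ℝ) = (2 + 3 * L) * T + (2 + 3 * L) := by
          rw [hcast]; ring
        linarith
    -- AM–GM replaces `12√(aT)` by `6a + 6T`. The cost bound is now affine in the number of
    -- terminals, so summing it over all sets only needs the total number of terminals.
    refine (hb T).trans ?_
    have h1 : 2 * √(a * T) ≤ a + T := by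
      rw [Real.sqrt_mul ha.le]
      nlinarith [sq_nonneg (√a - √(T : ℝ)), Real.sq_sqrt ha.le,
        Real.sq_sqrt (Nat.cast_nonneg (α := ℝ) T)]
    linarith

/-! ### Assembly of the construction. -/

/-- Independent spanning trees in an `(n, d, lam)`-graph, given parameters satisfying the numerical
conditions of the construction. -/
theorem IsNDLambdaGraph.exists_independentSpanningTrees {V : Type*} [Fintype V] [DecidableEq V]
    {G : SimpleGraph V} [DecidableRel G.Adj] {n d : ℕ} {lam : ℝ} (h : IsNDLambdaGraph G n d lam)
    (hn : 2 ≤ n) (hd : 1 ≤ d) (hlam0 : 0 < lam) (hlam : lam < d) (r : V)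
    {ε γ : ℝ} {k M N m : ℕ} (hε : 0 < ε)
    (hkd : (k : ℝ) + 1 + ε * d / 2 ≤ d)
    (hM2 : 2 ≤ M) (hM : 32 ≤ ε * M) (hγ : γ = ε / (8 * M))
    (hsplit : 48 * (d : ℝ) ^ 4 ≤ Real.exp (γ * d))
    {s Y₀ : ℝ} (hkN : k ≤ N) (hN : 1 ≤ N)
    (hs : 32 * (d : ℝ) ^ 4 * Real.exp (2 * (d * (k / N)) - s) ≤ 1)
    (hY : 64 * (d : ℝ) ^ 6 * Real.exp (-(Y₀ / N)) ≤ 1)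
    (hY1 : Y₀ ≤ γ * n / 2) (hY2 : Y₀ ≤ γ * d * (γ * d / (2 * lam)) ^ 2)
    (hm : lam * n / d < m) (hm4 : 8 * (m : ℝ) ≤ γ * n) (hgrow : 2 ≤ (γ * d / (2 * lam)) ^ 2)
    {a L : ℝ} (ha : 0 < a) (hL0 : 0 ≤ L) (hL : Real.log (3 * m / a) ≤ L)
    (hcost : (8 + 3 * L) * (s * n / d + k) + 6 * a * k + 17 * m ≤ γ * n) :
    ∃ T : Fin k → SimpleGraph V, IsIndependentSpanningTrees G r T := by
  classical
  have hn0 : (0 : ℝ) < n := by exact_mod_cast (by omega : 0 < n)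
  have hd0 : (0 : ℝ) < d := by exact_mod_cast (by omega : 0 < d)
  have hM0 : (0 : ℝ) < M := by exact_mod_cast (by omega : 0 < M)
  have hγ0 : 0 < γ := by rw [hγ]; positivity
  have hm1 : 1 ≤ m := by
    have : 0 < lam * n / d := by positivity
    have : (0 : ℝ) < m := this.trans hm
    exact_mod_cast this
  have hkd' : k ≤ d := by
    have : (k : ℝ) ≤ d := by
      have : 0 < ε * d := by positivity
      linarith
    exact_mod_cast this
  have hdeg : ∀ v, (G.neighborFinset v).card = d := fun v => by
    rw [G.card_neighborFinset_eq_degree]; exact h.regular v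
  obtain ⟨K, hKr, hKk⟩ := Finset.exists_subset_card_eq (s := G.neighborFinset r) (n := k)
    (by rw [hdeg]; exact hkd')
  let e : Fin k ≃ K := (K.equivFinOfCardEq hKk).symm
  let u : Fin k → V := fun i => e i
  have huinj : Function.Injective u := Subtype.val_injective.comp e.injective
  have huK : ∀ i, u i ∈ K := fun i => (e i).2
  have hKu : ∀ x ∈ K, ∃ i, u i = x := fun x hx => ⟨e.symm ⟨x, hx⟩, by simp [u]⟩
  have hru : ∀ i, G.Adj r (u i) := fun i => (G.mem_neighborFinset r _).mp (hKr (huK i))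
  have hrK : r ∉ K := fun hr => G.loopless.irrefl r ((G.mem_neighborFinset r r).mp (hKr hr))
  let D : V → Finset V := fun v => (G.neighborFinset v \ K).erase r
  let J : V → Finset (Fin k) := fun v => Finset.univ.filter fun i => ¬ G.Adj v (u i)
  -- A neighbour of `v` in `K` is lost as a connector, but it also removes one index for which `v`
  -- needs a connector. The surplus is therefore at least `d - k - 1` at every vertex.
  have hDJ : ∀ v, ((J v).card : ℝ) + ε * d / 2 ≤ (D v).card := by
    intro v
    have h1 : (J v).card + (G.neighborFinset v ∩ K).card = k := by
      have h2 : (Finset.univ.filter fun i => G.Adj v (u i)).card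
          = (G.neighborFinset v ∩ K).card := by
        rw [← Finset.card_image_of_injective _ huinj]
        congr 1
        ext x
        simp only [Finset.mem_image, Finset.mem_filter, Finset.mem_univ, true_and,
          Finset.mem_inter, SimpleGraph.mem_neighborFinset]
        constructor
        · rintro ⟨i, hi, rfl⟩; exact ⟨hi, huK i⟩
        · rintro ⟨hx, hxK⟩
          obtain ⟨i, rfl⟩ := hKu x hxK
          exact ⟨i, hx, rfl⟩
      rw [← h2, add_comm]
      refine (Finset.card_filter_add_card_filter_not _).trans ?_
      rw [Finset.card_univ, Fintype.card_fin]
    have h2 := Finset.card_sdiff_add_card_inter (G.neighborFinset v) K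
    rw [hdeg] at h2
    have h3 := Finset.pred_card_le_card_erase (s := G.neighborFinset v \ K) (a := r)
    have h4 : (J v).card + d ≤ (D v).card + 1 + k := by
      simp only [D]
      omega
    have h5 : ((J v).card : ℝ) + d ≤ (D v).card + 1 + k := by exact_mod_cast h4
    linarith
  have hDN : ∀ v, D v ⊆ G.neighborFinset v :=
    fun v => (Finset.erase_subset _ _).trans Finset.sdiff_subset
  have hDr : ∀ v, ∀ x ∈ D v, x ≠ r ∧ x ∉ K := fun v x hx => by
    simp only [D, Finset.mem_erase, Finset.mem_sdiff] at hx
    exact ⟨hx.1, hx.2.2⟩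
  obtain ⟨A₀, Z₀, hAZ, hsp⟩ := exists_splitting h.regular hd hε D hDN
    (fun v => by linarith [hDJ v, Nat.cast_nonneg (α := ℝ) (J v).card]) hM2 hM
    (by rw [← hγ]; exact hsplit)
  rw [← hγ] at hsp
  let A := (A₀ \ K).erase r
  let Z := (Z₀ \ K).erase r
  have hDA : ∀ v (B : Finset V), D v ∩ B ⊆ G.neighborFinset v ∩ (B \ K).erase r := by
    intro v B x hx
    rw [Finset.mem_inter] at hx
    obtain ⟨h1, h2⟩ := hDr v x hx.1
    simp [h1, h2, hx.2, (G.mem_neighborFinset v x).mp (hDN v hx.1)]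
  have hNA : ∀ v, γ * d ≤ (G.neighborFinset v ∩ A).card := fun v =>
    (hsp v).1.trans (by exact_mod_cast Finset.card_le_card (hDA v A₀))
  have hNZ : ∀ v, γ * d ≤ (G.neighborFinset v ∩ Z).card := fun v =>
    (hsp v).2.1.trans (by exact_mod_cast Finset.card_le_card (hDA v Z₀))
  let W : V → Finset V := fun v => D v \ (A₀ ∪ Z₀)
  have hWJ : ∀ v, ((J v).card : ℝ) + γ * d ≤ (W v).card := by
    intro v
    have h1 := Finset.card_sdiff_add_card_inter (D v) (A₀ ∪ Z₀)
    have h2 : ((W v).card : ℝ) + (D v ∩ (A₀ ∪ Z₀)).card = (D v).card := by exact_mod_cast h1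
    have h3 := (hsp v).2.2
    have h4 := hDJ v
    have h5 : γ * d ≤ ε * d / 4 := by
      have h6 : γ ≤ ε / 4 := by
        rw [hγ]
        refine div_le_div_of_nonneg_left hε.le (by norm_num) ?_
        have : (2 : ℝ) ≤ M := by exact_mod_cast hM2
        linarith
      calc γ * d ≤ ε / 4 * d := by gcongr
        _ = ε * d / 4 := by ring
    linarith
  obtain ⟨τ, hτZ, hτdisj, hτs, hτw⟩ := exists_colouring h.regular hd hkN hkd' hN Z W
    (fun v => Finset.sdiff_subset.trans (hDN v)) J (s₀ := γ * d) (by positivity) hWJ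
    (fun X hX => h.le_card_biUnion hn hd hlam0 hlam hγ0 (fun x _ => hNZ x) hY1
      (hY2.trans (by gcongr))) hs hY
  choose w hw hwinj using hτw
  -- double counting of the coloured vertices and of `A`
  have hdouble : ∀ B : Finset V,
      ∑ v, ((G.neighborFinset v ∩ B).card : ℝ) = d * B.card := by
    intro B
    have h1 : ∑ v, (G.neighborFinset v ∩ B).card = ∑ b ∈ B, (G.neighborFinset b).card := by
      have := Finset.sum_card_bipartiteAbove_eq_sum_card_bipartiteBelow (s := Finset.univ)
        (t := B) (fun v b => G.Adj v b)
      convert this using 2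
      · congr 1
        ext x
        simp [Finset.bipartiteAbove, and_comm]
      · congr 1
        ext x
        simp [Finset.bipartiteBelow, G.adj_comm]
    rw [Finset.sum_congr rfl fun b _ => hdeg b, Finset.sum_const, smul_eq_mul] at h1
    rw [← Nat.cast_sum, h1, Nat.cast_mul, mul_comm]
  have hcardV : ∑ _v : V, (1 : ℝ) = n := by simp [h.card_eq]
  have hA : γ * n ≤ A.card := by
    have h1 : ∑ _v : V, γ * d * 1 ≤ ∑ v, ((G.neighborFinset v ∩ A).card : ℝ) :=
      Finset.sum_le_sum fun v _ => by rw [mul_one]; exact hNA v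
    rw [← Finset.mul_sum, hcardV, hdouble] at h1
    refine le_of_mul_le_mul_left ?_ hd0
    linarith
  have hτcard : (∑ i, ((τ i).card : ℝ)) ≤ s * n / d := by
    have h1 : ∑ v, ((G.neighborFinset v ∩ Finset.univ.biUnion τ).card : ℝ) ≤ ∑ _v : V, s * 1 :=
      Finset.sum_le_sum fun v _ => by rw [mul_one]; exact hτs v
    rw [← Finset.mul_sum, hcardV, hdouble, Finset.card_biUnion (fun i _ j _ hij => hτdisj i j hij)]
      at h1
    rw [le_div_iff₀ hd0]
    push_cast at h1
    linarith
  have huZ : ∀ i, u i ∉ Z := fun i hi => by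
    simp only [Z, Finset.mem_erase, Finset.mem_sdiff] at hi
    exact hi.2.2 (huK i)
  have hAZ' : ∀ x ∈ Z, x ∉ A := fun x hx hx' => by
    simp only [Z, A, Finset.mem_erase, Finset.mem_sdiff] at hx hx'
    exact Finset.disjoint_left.mp hAZ hx'.2.1 hx.2.1
  obtain ⟨depth, cost, hdepth, hsize, hmono, hstep, hcostle⟩ := exists_depth_cost hm1 ha hL0 hL
  let nb : V → Finset V := fun x => G.neighborFinset x ∩ A
  let σ : Fin k → Finset V := fun i => insert (u i) (τ i)
  have hσcard : ∀ i, (σ i).card = (τ i).card + 1 := fun i =>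
    Finset.card_insert_of_notMem fun hi => huZ i (hτZ i hi)
  have hsum : ((∑ i, cost (σ i).card : ℕ) : ℝ) ≤ (8 + 3 * L) * (s * n / d + k) + 6 * a * k := by
    rw [Nat.cast_sum]
    calc ∑ i, ((cost (σ i).card : ℕ) : ℝ)
        ≤ ∑ i, ((8 + 3 * L) * (((τ i).card : ℝ) + 1) + 6 * a) := by
          refine Finset.sum_le_sum fun i _ => (hcostle _).trans_eq ?_
          rw [hσcard]; push_cast; ring
      _ = (8 + 3 * L) * ((∑ i, ((τ i).card : ℝ)) + k) + 6 * a * k := by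
          rw [Finset.sum_add_distrib, ← Finset.mul_sum, Finset.sum_add_distrib]
          simp only [Finset.sum_const, Finset.card_univ, Fintype.card_fin, nsmul_eq_mul, mul_one]
          ring
      _ ≤ _ := by gcongr
  have hjoin : ∀ X Y : Finset V, m ≤ X.card → m ≤ Y.card → ∃ x ∈ X, ∃ y ∈ Y, G.Adj x y := by
    intro X Y hX hY
    refine h.exists_adj hn hd hlam0 hlam (hm.trans_le ?_) (hm.trans_le ?_)
    exacts [by exact_mod_cast hX, by exact_mod_cast hY]
  obtain ⟨S, hS1, hS2, hS3, hS4⟩ := exists_disjoint_connected (G := G) (nb := nb)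
    (cap := ∑ i, cost (σ i).card + 16 * m) hm1
    (fun x y hy => (G.mem_neighborFinset x y).mp (Finset.mem_inter.mp hy).1)
    (fun X hX => by
      -- Fewer than `m` vertices of `A` are unseen by `X`, since otherwise `hjoin` would supply an
      -- edge to them. This extra `m` turns `16 * m` into the `17 * m` of `hcost`.
      have h1 : (A \ X.biUnion nb).card < m := by
        by_contra hge
        obtain ⟨x, hx, y, hy, hxy⟩ := hjoin X _ hX (not_lt.mp hge)
        rw [Finset.mem_sdiff] at hy
        refine hy.2 (Finset.mem_biUnion.mpr ⟨x, hx, Finset.mem_inter.mpr ⟨?_, hy.1⟩⟩)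
        exact (G.mem_neighborFinset x y).mpr hxy
      have h2 := Finset.le_card_sdiff (X.biUnion nb) A
      have h3 : ((∑ i, cost (σ i).card + 16 * m + m : ℕ) : ℝ) ≤ A.card := by
        push_cast at hsum ⊢
        linarith
      have h4 : ∑ i, cost (σ i).card + 16 * m + m ≤ A.card := by exact_mod_cast h3
      omega)
    hjoin
    (fun X hX => by
      have h1 : (X.card : ℝ) ≤ 2 * m := by exact_mod_cast hX
      have h2 := h.le_card_biUnion hn hd hlam0 hlam hγ0 (X := X) (fun x _ => hNA x)
        (t := 2 * X.card) (by linarith) (by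
          rw [mul_comm]
          gcongr)
      exact_mod_cast h2)
    hdepth hsize hmono hstep σ (fun i => Finset.insert_nonempty _ _)
    (fun i j hij => by
      rw [Finset.disjoint_insert_left, Finset.disjoint_insert_right, Finset.mem_insert, not_or]
      exact ⟨⟨huinj.ne hij, fun hi => huZ i (hτZ j hi)⟩, fun hj => huZ j (hτZ i hj),
        hτdisj i j hij⟩)
    (fun i p hp x hpx => by
      have hpA := (Finset.mem_inter.mp hpx).2
      rcases Finset.mem_insert.mp hp with rfl | hp
      · simp only [A, Finset.mem_erase, Finset.mem_sdiff] at hpA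
        exact hpA.2.2 (huK i)
      · exact hAZ' p (hτZ i hp) hpA)
    le_rfl
  have hSmem : ∀ i, ∀ x ∈ S i, x ≠ r ∧ (x ∈ K ∨ x ∈ A₀ ∪ Z₀) := by
    intro i x hx
    rcases hS2 i x hx with hx | ⟨y, hx⟩
    · rcases Finset.mem_insert.mp hx with rfl | hx
      · exact ⟨(hru i).ne', Or.inl (huK i)⟩
      · have h1 := hτZ i hx
        simp only [Z, Finset.mem_erase, Finset.mem_sdiff] at h1
        exact ⟨h1.1, Or.inr (Finset.mem_union_right _ h1.2.1)⟩
    · have h1 := (Finset.mem_inter.mp hx).2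
      simp only [A, Finset.mem_erase, Finset.mem_sdiff] at h1
      exact ⟨h1.1, Or.inr (Finset.mem_union_left _ h1.2.1)⟩
  let R : Finset V := Finset.univ.filter fun x => x ≠ r ∧ x ∉ K ∧ x ∉ A₀ ∪ Z₀
  have hJmem : ∀ v i, (∀ x ∈ S i, ¬ G.Adj v x) → i ∈ J v := fun v i hv =>
    Finset.mem_filter.mpr ⟨Finset.mem_univ _, hv _ (hS1 i (Finset.mem_insert_self _ _))⟩
  refine _root_.exists_independentSpanningTrees S u R
    (fun i => hS1 i (Finset.mem_insert_self _ _)) hru (fun i hi => (hSmem i r hi).1 rfl)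
    (by simp [R]) (fun i => ?_) hS3 hS4 w (fun v i hv => ?_) (fun v i j hij hi hj => ?_)
  · rw [Finset.disjoint_left]
    intro x hx hxS
    obtain ⟨-, -, h1, h2⟩ := Finset.mem_filter.mp hx
    exact (hSmem i x hxS).2.elim h1 h2
  · obtain ⟨h1, z, hz, hadj⟩ := hw v i (hJmem v i hv)
    rw [Finset.mem_sdiff] at h1
    obtain ⟨h2, h3⟩ := hDr v _ h1.1
    refine ⟨Finset.mem_filter.mpr ⟨Finset.mem_univ _, h2, h3, h1.2⟩,
      (G.mem_neighborFinset v _).mp (hDN v h1.1), z, ?_, hadj⟩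
    exact hS1 i (Finset.mem_insert_of_mem hz)
  · exact hwinj v i (hJmem v i hi) j (hJmem v j hj) hij

/-! ### Numerical choice of the parameters. -/

open Filter in
/-- The lower bounds on the degree needed in the construction. -/
theorem exists_degree_threshold {ε γ K : ℝ} (hε : 0 < ε) (hγ : 0 < γ) (hK : 0 < K) :
    ∃ d₀ : ℝ, ∀ d : ℝ, d₀ ≤ d → 3 ≤ d ∧ 4 ≤ ε * d ∧ 128 ≤ γ * d ∧
      48 * d ^ 4 ≤ Real.exp (γ * d) ∧ 32 * d ^ 4 ≤ Real.exp (2 * d / (K * Real.log d)) := by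
  have h1 : ∀ᶠ d : ℝ in atTop, 3 ≤ d := eventually_ge_atTop 3
  have h2 : ∀ᶠ d : ℝ in atTop, 4 ≤ ε * d :=
    (tendsto_id.const_mul_atTop hε).eventually_ge_atTop 4
  have h3 : ∀ᶠ d : ℝ in atTop, 128 ≤ γ * d :=
    (tendsto_id.const_mul_atTop hγ).eventually_ge_atTop 128
  have h4 : ∀ᶠ d : ℝ in atTop, 48 / γ ^ 4 ≤ Real.exp (γ * d) / (γ * d) ^ 4 :=
    ((Real.tendsto_exp_div_pow_atTop 4).comp
      (tendsto_id.const_mul_atTop hγ)).eventually_ge_atTop _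
  have h5 : ∀ᶠ d : ℝ in atTop, 32 * K ^ 8 ≤ Real.exp (1 / K * √d) / (1 / K * √d) ^ 8 :=
    ((Real.tendsto_exp_div_pow_atTop 8).comp
      (Real.tendsto_sqrt_atTop.const_mul_atTop (by positivity))).eventually_ge_atTop _
  obtain ⟨d₀, hd₀⟩ := (h1.and (h2.and (h3.and (h4.and h5)))).exists_forall_of_atTop
  refine ⟨d₀, fun d hd => ?_⟩
  obtain ⟨g1, g2, g3, g4, g5⟩ := hd₀ d hd
  have hd0 : 0 < d := by linarith
  refine ⟨g1, g2, g3, ?_, ?_⟩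
  · rw [le_div_iff₀ (by positivity)] at g4
    calc 48 * d ^ 4 = 48 / γ ^ 4 * (γ * d) ^ 4 := by field_simp
      _ ≤ _ := g4
  · rw [le_div_iff₀ (by positivity)] at g5
    have hs0 : 0 < √d := Real.sqrt_pos.mpr hd0
    have hs2 : √d ^ 2 = d := Real.sq_sqrt hd0.le
    -- Through this bound the exponent `2d / (K log d)` is at least `√d / K`, which beats any power
    -- of `d`.
    have hlog : Real.log d ≤ 2 * √d := by
      rw [← hs2, Real.log_pow, Real.sqrt_sq hs0.le]
      push_cast
      linarith [Real.log_le_sub_one_of_pos hs0]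
    have hlog0 : 0 < Real.log d := Real.log_pos (by linarith)
    calc 32 * d ^ 4 = 32 * K ^ 8 * (1 / K * √d) ^ 8 := by
          have : √d ^ 8 = d ^ 4 := by rw [← hs2, ← pow_mul, Real.sqrt_sq hs0.le]
          rw [mul_pow, this]
          field_simp
      _ ≤ Real.exp (1 / K * √d) := g5
      _ ≤ Real.exp (2 * d / (K * Real.log d)) := by
          refine Real.exp_le_exp.mpr ?_
          rw [le_div_iff₀ (by positivity)]
          calc 1 / K * √d * (K * Real.log d) = √d * Real.log d := by field_simp
            _ ≤ √d * (2 * √d) := by gcongr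
            _ = 2 * √d ^ 2 := by ring
            _ = 2 * d := by rw [hs2]

/-- Independent spanning trees in an `(n, d, lam)`-graph of sufficiently large degree. -/
theorem IsNDLambdaGraph.exists_independentSpanningTrees_of_large {V : Type*} [Fintype V]
    [DecidableEq V] {G : SimpleGraph V} [DecidableRel G.Adj] {n d : ℕ} {lam : ℝ}
    (h : IsNDLambdaGraph G n d lam) (hn : 2 ≤ n) (hdn : d ≤ n) (hlam0 : 0 < lam) (hlam : lam < d)
    (r : V) {ε γ K C c : ℝ} {k M : ℕ} (hε : 0 < ε) (hM2 : 2 ≤ M) (hM : 32 ≤ ε * M)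
    (hγ : γ = ε / (8 * M)) (hγ0 : 0 < γ) (hK1 : 1 ≤ K) (hγK : γ * K = 448) (hC0 : 0 < C)
    (hC1 : 128 ≤ γ * C) (hC2 : 104 * K ≤ γ ^ 3 * C ^ 2) (hc1 : 52 * K * c ≤ γ)
    (hc2 : 112 * c ≤ γ) (hCd : C * Real.log d ≤ d / lam) (hdc : d * Real.log n ^ 2 ≤ c * n)
    (g1 : (3 : ℝ) ≤ d) (g3 : 128 ≤ γ * d) (g4 : 48 * (d : ℝ) ^ 4 ≤ Real.exp (γ * d))
    (g5 : 32 * (d : ℝ) ^ 4 ≤ Real.exp (2 * d / (K * Real.log d)))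
    (hkd : (k : ℝ) + 1 + ε * d / 2 ≤ d) :
    ∃ T : Fin k → SimpleGraph V, IsIndependentSpanningTrees G r T := by
  have hd0 : (0 : ℝ) < d := by linarith
  have hd1 : 1 ≤ d := by exact_mod_cast (by linarith : (1 : ℝ) ≤ d)
  have hn0 : (0 : ℝ) < n := by exact_mod_cast (by omega : 0 < n)
  have hdn' : (d : ℝ) ≤ n := by exact_mod_cast hdn
  have hK0 : 0 < K := by linarith
  set ℓ := Real.log d with hℓ
  have hℓ1 : 1 ≤ ℓ := by
    rw [hℓ, Real.le_log_iff_exp_le hd0]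
    linarith [Real.exp_one_lt_d9]
  have hℓ0 : 0 < ℓ := by linarith
  have hℓn : ℓ ≤ Real.log n := Real.log_le_log hd0 hdn'
  have hdℓ2 : d * ℓ ^ 2 ≤ c * n := le_trans (by gcongr) hdc
  have hdℓ : ℓ * d ≤ c * n := by
    refine le_trans ?_ hdℓ2
    rw [mul_comm, sq]
    gcongr
    exact le_mul_of_one_le_left hℓ0.le hℓ1
  have hεd : 0 < ε * d := by positivity
  have hkd' : (k : ℝ) ≤ d := by linarith
  have hKd : (d : ℝ) ≤ K * d * ℓ := by
    calc (d : ℝ) = 1 * d * 1 := by ring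
      _ ≤ K * d * ℓ := by gcongr
  set N := ⌈K * d * ℓ⌉₊ with hN
  have hN1 : K * d * ℓ ≤ N := Nat.le_ceil _
  have hN2 : (N : ℝ) ≤ 2 * (K * d * ℓ) := by
    have := Nat.ceil_lt_add_one (a := K * d * ℓ) (by positivity)
    linarith
  have hN0 : (0 : ℝ) < N := by linarith
  have hkN : k ≤ N := by exact_mod_cast (by linarith : (k : ℝ) ≤ N)
  have hratio : γ * C * ℓ / 2 ≤ γ * d / (2 * lam) := by
    calc γ * C * ℓ / 2 = γ / 2 * (C * ℓ) := by ring
      _ ≤ γ / 2 * (d / lam) := by gcongr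
      _ = γ * d / (2 * lam) := by field_simp
  set m := ⌊lam * n / d⌋₊ + 1 with hm
  have hm1 : lam * n / d < m := by
    rw [hm]; push_cast; exact Nat.lt_floor_add_one _
  have hm2 : (m : ℝ) ≤ γ * n / 64 := by
    have h1 : ((⌊lam * n / d⌋₊ : ℕ) : ℝ) ≤ lam * n / d := Nat.floor_le (by positivity)
    have h2 : lam * n / d ≤ γ * n / 128 := by
      have h3 : 64 ≤ γ * d / (2 * lam) := by
        have h4 : 128 * 1 ≤ γ * C * ℓ := mul_le_mul hC1 hℓ1 zero_le_one (by positivity)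
        linarith
      rw [le_div_iff₀ (by positivity)] at h3
      rw [div_le_iff₀ hd0]
      calc lam * n = 64 * (2 * lam) * n / 128 := by ring
        _ ≤ γ * d * n / 128 := by gcongr
        _ = γ * n / 128 * d := by ring
    have h3 : 1 ≤ γ * n / 128 := by
      rw [le_div_iff₀ (by norm_num), one_mul]
      exact g3.trans (by gcongr)
    rw [hm]
    push_cast
    linarith
  have hdexp : Real.exp ℓ = d := Real.exp_log hd0
  -- The choices: `s` is twice the bound `2d/(Kℓ)` for the mean term in the upper tail; `Y₀ / N ≥
  -- 13ℓ` makes the miss probability at most `d⁻¹³`; `a` makes `6ak ≤ γn/8`; and `L = 2ℓ` works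
  -- because `3m/a ≤ d²`.
  refine h.exists_independentSpanningTrees hn hd1 hlam0 hlam r (γ := γ) (M := M) (N := N)
    (m := m) (s := 4 * d / (K * ℓ)) (Y₀ := 26 * K * (d * ℓ ^ 2)) (a := γ / 48 * n / d)
    (L := 2 * ℓ) hε hkd hM2 hM hγ g4 hkN (by exact_mod_cast hN0) ?_ ?_ ?_ ?_ hm1 ?_ ?_
    (by positivity) (by linarith) ?_ ?_
  · have h1 : (k : ℝ) / N ≤ d / (K * d * ℓ) := by gcongr
    have h2 : 2 * (d * ((k : ℝ) / N)) ≤ 2 * d / (K * ℓ) := by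
      calc 2 * (d * ((k : ℝ) / N)) ≤ 2 * (d * (d / (K * d * ℓ))) := by gcongr
        _ = 2 * d / (K * ℓ) := by field_simp
    have h3 : 4 * (d : ℝ) / (K * ℓ) = 2 * (2 * d / (K * ℓ)) := by ring
    calc 32 * (d : ℝ) ^ 4 * Real.exp (2 * (d * (k / N)) - 4 * d / (K * ℓ))
        ≤ Real.exp (2 * d / (K * ℓ)) * Real.exp (-(2 * d / (K * ℓ))) := by
          gcongr
          linarith
      _ = 1 := by rw [← Real.exp_add]; simp
  · have h1 : 13 * ℓ ≤ 26 * K * (d * ℓ ^ 2) / N := by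
      rw [le_div_iff₀ hN0]
      calc 13 * ℓ * N ≤ 13 * ℓ * (2 * (K * d * ℓ)) := by gcongr
        _ = 26 * K * (d * ℓ ^ 2) := by ring
    have h2 : Real.exp (13 * ℓ) = (d : ℝ) ^ 13 := by
      rw [← hdexp, ← Real.exp_nat_mul]
      norm_num
    have h3 : 64 * (d : ℝ) ^ 6 ≤ (d : ℝ) ^ 13 := by
      have h4 : (3 : ℝ) ^ 7 ≤ (d : ℝ) ^ 7 := by gcongr
      calc 64 * (d : ℝ) ^ 6 ≤ (d : ℝ) ^ 7 * d ^ 6 := by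
            gcongr
            linarith
        _ = (d : ℝ) ^ 13 := by ring
    calc 64 * (d : ℝ) ^ 6 * Real.exp (-(26 * K * (d * ℓ ^ 2) / N))
        ≤ Real.exp (13 * ℓ) * Real.exp (-(13 * ℓ)) := by
          rw [h2]
          gcongr
      _ = 1 := by rw [← Real.exp_add]; simp
  · calc 26 * K * (d * ℓ ^ 2) ≤ 26 * K * (c * n) := by gcongr
      _ = 52 * K * c * n / 2 := by ring
      _ ≤ γ * n / 2 := by gcongr
  · calc 26 * K * (d * ℓ ^ 2) = 104 * K * (d * ℓ ^ 2) / 4 := by ring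
      _ ≤ γ ^ 3 * C ^ 2 * (d * ℓ ^ 2) / 4 := by gcongr
      _ = γ * d * (γ * C * ℓ / 2) ^ 2 := by ring
      _ ≤ γ * d * (γ * d / (2 * lam)) ^ 2 := by gcongr
  · have : 0 ≤ γ * n := by positivity
    linarith
  · have h4 : 128 * 1 ≤ γ * C * ℓ := mul_le_mul hC1 hℓ1 zero_le_one (by positivity)
    have h5 : 2 ≤ γ * d / (2 * lam) := by linarith
    calc (2 : ℝ) ≤ 2 ^ 2 := by norm_num
      _ ≤ _ := by gcongr
  · have hm0 : (0 : ℝ) < m := by rw [hm]; positivity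
    rw [Real.log_le_iff_le_exp (by positivity), two_mul, Real.exp_add, hdexp,
      div_le_iff₀ (by positivity)]
    calc 3 * (m : ℝ) ≤ 3 * (γ * n / 64) := by gcongr
      _ = γ * n * 3 / 64 := by ring
      _ ≤ γ * n * d / 48 := by
          have : 0 ≤ γ * n := by positivity
          nlinarith
      _ = d * d * (γ / 48 * n / d) := by field_simp
  -- Coloured terminals, root terminals and the `a`-term cost at most `γn/8` each, and `17m ≤
  -- 17γn/64`. For the coloured ones the bound is `14ℓ · 4n/(Kℓ) = 56n/K`, whence `γK = 448`.
  · have h1 : 8 + 3 * (2 * ℓ) ≤ 14 * ℓ := by linarith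
    have h2 : (8 + 3 * (2 * ℓ)) * (4 * d / (K * ℓ) * n / d + k)
        ≤ 14 * ℓ * (4 * d / (K * ℓ) * n / d + d) := by gcongr
    have h3 : 14 * ℓ * (4 * d / (K * ℓ) * n / d + d) = γ * n / 8 + 14 * (ℓ * d) := by
      have : γ = 448 / K := by rw [eq_div_iff hK0.ne']; exact hγK
      rw [this]
      field_simp
      ring
    have h4 : 14 * (ℓ * d) ≤ γ * n / 8 := by
      calc 14 * (ℓ * d) ≤ 14 * (c * n) := by gcongr
        _ = 112 * c * n / 8 := by ring
        _ ≤ γ * n / 8 := by gcongr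
    have h5 : 6 * (γ / 48 * n / d) * k ≤ γ * n / 8 := by
      calc 6 * (γ / 48 * n / d) * k ≤ 6 * (γ / 48 * n / d) * d := by gcongr
        _ = γ * n / 8 := by field_simp; norm_num
    have h6 : 0 ≤ γ * n := by positivity
    linarith

/-- Elementary consequences of the hypotheses on `n`, `d` and `lam`. -/
theorem IsNDLambdaGraph.basic_bounds {V : Type*} [Fintype V] [DecidableEq V] {G : SimpleGraph V}
    [DecidableRel G.Adj] {n d : ℕ} {lam : ℝ} (h : IsNDLambdaGraph G n d lam) (r : V) (hd : 2 ≤ d)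
    {C c : ℝ} (hC : 4 ≤ C) (hc2 : 2 * c ≤ 1) (hCd : C * Real.log d ≤ d / lam)
    (hdc : (d : ℝ) ≤ c * (n / (Real.log n) ^ 2)) :
    3 ≤ n ∧ d ≤ n ∧ 0 < lam ∧ lam < d ∧ d * Real.log n ^ 2 ≤ c * n ∧ C ^ 2 ≤ 16 * d := by
  have hd2 : (2 : ℝ) ≤ d := by exact_mod_cast hd
  have hd0 : (0 : ℝ) < d := by linarith
  have hlog2 : (1 : ℝ) / 2 ≤ Real.log d :=
    le_trans (by linarith [Real.log_two_gt_d9]) (Real.log_le_log two_pos hd2)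
  have hdn1 : d + 1 ≤ n := by
    have h1 := G.degree_lt_card_verts r
    rw [h.regular r, h.card_eq] at h1
    omega
  have hn0 : (0 : ℝ) < n := by exact_mod_cast (by omega : 0 < n)
  have hlogn : 1 ≤ Real.log n := by
    rw [Real.le_log_iff_exp_le hn0]
    have h3 : (3 : ℝ) ≤ n := by exact_mod_cast (by omega : 3 ≤ n)
    linarith [Real.exp_one_lt_d9]
  have hdlogn : d * Real.log n ^ 2 ≤ c * n := by
    rwa [mul_div_assoc', le_div_iff₀ (by positivity)] at hdc
  have h2dn : 2 * d ≤ n := by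
    have h1 : (d : ℝ) * 1 ≤ d * Real.log n ^ 2 := by
      gcongr
      exact one_le_pow₀ hlogn
    have h2 : 2 * c * n ≤ 1 * n := by gcongr
    have : 2 * (d : ℝ) ≤ n := by linarith
    exact_mod_cast this
  have hClog : C / 2 ≤ C * Real.log d := by
    calc C / 2 = C * (1 / 2) := by ring
      _ ≤ C * Real.log d := by gcongr
  -- If `lam ≤ 0`, then `d / lam ≤ 0` (also for `lam = 0`, by the convention on division),
  -- contradicting the positive lower bound.
  have hlam0 : 0 < lam := by
    by_contra hneg
    have h1 := div_nonpos_of_nonneg_of_nonpos hd0.le (not_lt.mp hneg)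
    linarith
  have hCl : C / 2 * lam ≤ d := by
    rw [← le_div_iff₀ hlam0]
    exact hClog.trans hCd
  have hlam : lam < d := by
    have : 2 * lam ≤ C / 2 * lam := by gcongr; linarith
    linarith
  refine ⟨by omega, by omega, hlam0, hlam, hdlogn, ?_⟩
  have hsq := h.sqrt_le (by omega) (by omega) hlam h2dn
  have hs0 : 0 < √(d : ℝ) := Real.sqrt_pos.mpr hd0
  have hs2 : √(d : ℝ) * √d = d := Real.mul_self_sqrt hd0.le
  have h1 : C / 4 * √(d : ℝ) ≤ √d * √d := by
    rw [hs2]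
    calc C / 4 * √(d : ℝ) ≤ C / 4 * (2 * lam) := by gcongr
      _ = C / 2 * lam := by ring
      _ ≤ d := hCl
  have h2 := le_of_mul_le_mul_right h1 hs0
  calc C ^ 2 = 16 * (C / 4) ^ 2 := by ring
    _ ≤ 16 * √(d : ℝ) ^ 2 := by gcongr
    _ = 16 * d := by rw [sq, hs2]

theorem theorem1p4 (ε : ℝ) (hε : 0 < ε) :
    ∃ C c : ℝ, 0 < C ∧ 0 < c ∧
      ∀ (V : Type*) [Fintype V] [DecidableEq V] (G : SimpleGraph V) [DecidableRel G.Adj]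
        (n d : ℕ) (lam : ℝ),
        IsNDLambdaGraph G n d lam → 2 ≤ d →
        C * Real.log d ≤ d / lam →
        (d : ℝ) ≤ c * (n / (Real.log n) ^ 2) →
        ∀ r : V, ∃ k : ℕ, (1 - ε) * d ≤ k ∧
          ∃ T : Fin k → SimpleGraph V, IsIndependentSpanningTrees G r T := by
  -- For `ε ≥ 1` the empty family suffices.
  by_cases hε1 : 1 ≤ ε
  · refine ⟨1, 1, one_pos, one_pos, ?_⟩
    intro V _ _ G _ n d lam _ _ _ _ r
    refine ⟨0, ?_, fun i => i.elim0, ⟨fun i => i.elim0, fun i => i.elim0, fun i => i.elim0,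
      fun i => i.elim0⟩⟩
    rw [Nat.cast_zero]
    exact mul_nonpos_of_nonpos_of_nonneg (by linarith) (Nat.cast_nonneg d)
  push Not at hε1
  obtain ⟨M, hM⟩ := exists_nat_ge (32 / ε)
  rw [div_le_iff₀ hε, mul_comm] at hM
  have hM32 : (32 : ℝ) ≤ M := by nlinarith [Nat.cast_nonneg (α := ℝ) M]
  have hM2 : 2 ≤ M := by
    have : 32 ≤ M := by exact_mod_cast hM32
    omega
  obtain ⟨γ, hγ⟩ : ∃ γ : ℝ, γ = ε / (8 * M) := ⟨_, rfl⟩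
  have hγ0 : 0 < γ := by rw [hγ]; positivity
  have hγ1 : γ ≤ 1 := by
    rw [hγ, div_le_one (by positivity)]
    linarith
  obtain ⟨K, hγK⟩ : ∃ K : ℝ, γ * K = 448 := ⟨448 / γ, by field_simp⟩
  have hK1 : 1 ≤ K := by nlinarith
  have hK0 : 0 < K := by linarith
  obtain ⟨d₀, hd₀⟩ := exists_degree_threshold hε hγ0 hK0
  -- The last condition forces the degree to be large: `16d₀ ≤ C² ≤ 16d`, where the second
  -- inequality comes from `basic_bounds`.
  obtain ⟨C, hC4, hC1, hC2, hC3⟩ : ∃ C : ℝ, 4 ≤ C ∧ 128 ≤ γ * C ∧ 104 * K ≤ γ ^ 3 * C ^ 2 ∧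
      16 * d₀ ≤ C ^ 2 := by
    have p1 : 0 ≤ 16 * |d₀| := by positivity
    have p2 : 0 ≤ 104 * K / γ ^ 3 := by positivity
    have p3 : 0 ≤ 128 / γ := by positivity
    have hle : ∀ x : ℝ, x ≤ 4 + 16 * |d₀| + 104 * K / γ ^ 3 + 128 / γ →
        x ≤ (4 + 16 * |d₀| + 104 * K / γ ^ 3 + 128 / γ) ^ 2 := fun x hx =>
      hx.trans (le_self_pow₀ (by linarith) two_ne_zero)
    refine ⟨4 + 16 * |d₀| + 104 * K / γ ^ 3 + 128 / γ, by linarith, ?_, ?_, hle _ ?_⟩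
    · calc (128 : ℝ) = γ * (128 / γ) := by field_simp
        _ ≤ _ := by gcongr; linarith
    · calc 104 * K = γ ^ 3 * (104 * K / γ ^ 3) := by field_simp
        _ ≤ _ := by gcongr; exact hle _ (by linarith)
    · linarith [le_abs_self d₀]
  obtain ⟨c, hc0, hc1, hc2⟩ : ∃ c : ℝ, 0 < c ∧ 52 * K * c ≤ γ ∧ 112 * c ≤ γ := by
    refine ⟨γ / (52 * K + 112), by positivity, ?_, ?_⟩
    · rw [mul_div_assoc', div_le_iff₀ (by positivity)]
      nlinarith
    · rw [mul_div_assoc', div_le_iff₀ (by positivity)]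
      nlinarith
  refine ⟨C, c, by linarith, hc0, ?_⟩
  intro V _ _ G _ n d lam h hd2 hCd hdc r
  obtain ⟨hn3, hdn, hlam0, hlam, hdlogn, hCd2⟩ :=
    h.basic_bounds r hd2 hC4 (by linarith) hCd hdc
  obtain ⟨g1, g2, g3, g4, g5⟩ := hd₀ d (by linarith)
  refine ⟨⌈(1 - ε) * d⌉₊, Nat.le_ceil _, ?_⟩
  have hk1 := Nat.ceil_lt_add_one (a := (1 - ε) * (d : ℝ))
    (mul_nonneg (by linarith) (Nat.cast_nonneg d))
  exact h.exists_independentSpanningTrees_of_large (by omega) hdn hlam0 hlam r hε hM2 hM hγ hγ0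
    hK1 hγK (by linarith) hC1 hC2 hc1 hc2 hCd hdlogn g1 g3 g4 g5 (by linarith)
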